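/- Let $(M,g)$ be a smooth $4$-dimensional Riemannian manifold (not necessarily complete) with Ricci tensor $Rc$, scalar curvature $R$ and Weyl tensor $W$, and let $f$ be a smooth, non-constant function on $M$ with $\nabla df=-Rc+\lambda g$ for some constant $\lambda\in\mathbb R$ (a gradient Ricci soliton). Assume that $g$ has harmonic Weyl curvature, $\delta W=0$. Put $\mathcal A:=Rc-\frac R6 g$ and let $M_{\mathcal A}$ be the set of points of $M$ near which the number of distinct eigenvalues of $\mathcal A$ is constant. Let $U$ be an open subset of $M_{\mathcal A}\cap\{\nabla f\neq0\}$ and let $E_1,E_2,E_3,E_4$ be an adapted frame field on $U$, that is, smooth orthonormal vector fields on $U$ with $Rc(E_i,\cdot)=\lambda_i\,g(E_i,\cdot)$ for functions $\lambda_1,\dots,\lambda_4$ on $U$, such that (i) $E_1=\frac{\nabla f}{|\nabla f|}$; (ii) $E_2,E_3,E_4$ are tangent to the level hypersurfaces of $f$; (iii) if $D_1,\dots,D_k$ are the eigenspace distributions of $\mathcal A$ on $U$, listed in a suitable order with $E_1\in D_1$, and $d_l=\dim D_l$, then $E_1,\dots,E_{d_1}\in D_1$, $E_{d_1+1},\dots,E_{d_1+d_2}\in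 D_2$, and so on. Then the eigenfunctions $\lambda_2,\lambda_3,\lambda_4$ cannot be pairwise distinct: at least two of the three functions coincide on $U$. -/

import Mathlib

open Bundle Manifold Filter Topology
open scoped ContDiff

noncomputable section

namespace Soliton

/-- The tangent space at `x` of an `n`-dimensional manifold modelled on `ℝⁿ`. -/
abbrev Tan (n : ℕ) {M : Type*} [TopologicalSpace M]
    [ChartedSpace (EuclideanSpace ℝ (Fin n)) M] (x : M) : Type :=
  TangentSpace (𝓡 n) x

section Geometry

variable {n : ℕ} {M : Type*} [TopologicalSpace M] [ChartedSpace (EuclideanSpace ℝ (Fin n)) M]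
  [IsManifold (𝓡 n) ∞ M]

instance instFiniteDimensionalTan (x : M) : FiniteDimensional ℝ (Tan n x) :=
  inferInstanceAs (FiniteDimensional ℝ (EuclideanSpace ℝ (Fin n)))

/-- The vector field `V` is smooth on the set `U`. -/
def SmoothFieldOn (V : ∀ x : M, Tan n x) (U : Set M) : Prop :=
  ContMDiffOn (𝓡 n) (𝓡 n).tangent ∞ (fun x => (⟨x, V x⟩ : TangentBundle (𝓡 n) M)) U

/-- The directional derivative `v φ = dφ(v)` of a function `φ` along a tangent vector `v`. -/
def dirDeriv (φ : M → ℝ) (x : M) (v : Tan n x) : ℝ :=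
  mvfderiv (𝓡 n) φ x v

/-- A vector field, smooth near `x`, whose value at `x` is `v`. It is used to evaluate expressions
which are tensorial, so that only the value at `x` matters. -/
def extField {x : M} (v : Tan n x) : ∀ y : M, Tan n y :=
  FiberBundle.extend (EuclideanSpace ℝ (Fin n)) (E := fun y : M => TangentSpace (𝓡 n) y) v

variable [RiemannianBundle (fun x : M => TangentSpace (𝓡 n) x)]

/-- The Riemannian metric. -/
def metric (x : M) (v w : Tan n x) : ℝ :=
  inner ℝ v w

/-- An orthonormal basis of the tangent space at `x`. -/
def onb (x : M) : OrthonormalBasis (Fin (Module.finrank ℝ (Tan n x))) ℝ (Tan n x) :=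
  stdOrthonormalBasis ℝ (Tan n x)

/-- The right-hand side of the Koszul formula
`2⟨∇_X Y, Z⟩ = X⟨Y,Z⟩ + Y⟨X,Z⟩ - Z⟨X,Y⟩ + ⟨[X,Y],Z⟩ - ⟨[X,Z],Y⟩ - ⟨[Y,Z],X⟩`. -/
def koszul (X Y Z : ∀ x : M, Tan n x) (x : M) : ℝ :=
  dirDeriv (fun y => metric y (Y y) (Z y)) x (X x)
    + dirDeriv (fun y => metric y (X y) (Z y)) x (Y x)
    - dirDeriv (fun y => metric y (X y) (Y y)) x (Z x)
    + metric x (VectorField.mlieBracket (𝓡 n) X Y x) (Z x)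
    - metric x (VectorField.mlieBracket (𝓡 n) X Z x) (Y x)
    - metric x (VectorField.mlieBracket (𝓡 n) Y Z x) (X x)

/-- The Levi-Civita covariant derivative `∇_v Y` of the field `Y` along the vector `v` at `x`. -/
def covAt (x : M) (v : Tan n x) (Y : ∀ y : M, Tan n y) : Tan n x :=
  ∑ i, (koszul (extField v) Y (extField (onb x i)) x / 2) • onb x i

/-- The vector field `∇_X Y`. -/
def cov (X Y : ∀ x : M, Tan n x) : ∀ x : M, Tan n x :=
  fun x => covAt x (X x) Y

/-- The field `R(X,Y)Z = ∇_X ∇_Y Z - ∇_Y ∇_X Z - ∇_{[X,Y]} Z`. -/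
def curvField (X Y Z : ∀ x : M, Tan n x) : ∀ x : M, Tan n x :=
  fun x => cov X (cov Y Z) x - cov Y (cov X Z) x - cov (VectorField.mlieBracket (𝓡 n) X Y) Z x

/-- The curvature tensor `R(u,v,w,z) = ⟨R(u,v)w, z⟩` at `x`. -/
def riem (x : M) (u v w z : Tan n x) : ℝ :=
  metric x (curvField (extField u) (extField v) (extField w) x) z

/-- The Ricci tensor, `Ric(v,w) = ∑ᵢ R(bᵢ,v,w,bᵢ)` for an orthonormal basis `b`; it is positive
on round spheres. -/
def ricci (x : M) (v w : Tan n x) : ℝ :=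
  ∑ i, riem x (onb x i) v w (onb x i)

variable (n) in
/-- The scalar curvature. -/
def scal (x : M) : ℝ :=
  ∑ i, ricci x (onb (n := n) x i) (onb x i)

/-- The Weyl tensor (for `n ≥ 3`). -/
def weyl (x : M) (u v w z : Tan n x) : ℝ :=
  riem x u v w z
    - 1 / ((n : ℝ) - 2) * (ricci x v w * metric x u z + ricci x u z * metric x v w
        - ricci x u w * metric x v z - ricci x v z * metric x u w)
    + scal n x / (((n : ℝ) - 1) * ((n : ℝ) - 2))
        * (metric x v w * metric x u z - metric x u w * metric x v z)

/-- The covariant derivative `(∇_a T)(u,v,w,z)` of a covariant 4-tensor `T` at `x`. -/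
def covTensor (T : ∀ x : M, Tan n x → Tan n x → Tan n x → Tan n x → ℝ)
    (x : M) (a u v w z : Tan n x) : ℝ :=
  dirDeriv (fun y => T y (extField u y) (extField v y) (extField w y) (extField z y)) x a
    - T x (covAt x a (extField u)) v w z - T x u (covAt x a (extField v)) w z
    - T x u v (covAt x a (extField w)) z - T x u v w (covAt x a (extField z))

variable (n M) in
/-- Harmonic Weyl curvature: `δW = 0`, where `δW(v,w,z) = -∑ᵢ (∇_{bᵢ} W)(bᵢ,v,w,z)`. -/
def HarmonicWeyl : Prop :=
  ∀ (x : M) (v w z : Tan n x),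
    -∑ i, covTensor weyl x (onb x i) (onb x i) v w z = 0

/-- The gradient of `f`. -/
def grad (f : M → ℝ) (x : M) : Tan n x :=
  ∑ i, dirDeriv f x (onb x i) • onb x i

/-- The Hessian `∇df(u,v) = ⟨∇_u ∇f, v⟩`. -/
def hess (f : M → ℝ) (x : M) (u v : Tan n x) : ℝ :=
  metric x (covAt x u (grad f)) v

variable (n) in
/-- `(M,g,f)` is a gradient Ricci soliton, `∇df = -Ric + lam g`, with `f` smooth. -/
structure IsGradientSoliton (f : M → ℝ) (lam : ℝ) : Prop where
  smooth : ContMDiff (𝓡 n) 𝓘(ℝ, ℝ) ∞ f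
  equation : ∀ (x : M) (u v : Tan n x), hess f x u v = -ricci x u v + lam * metric x u v

/-- The tensor `A = Ric - R / (2n - 2) g`. -/
def schoutenA (x : M) (v w : Tan n x) : ℝ :=
  ricci x v w - scal n x / (2 * (n : ℝ) - 2) * metric x v w

variable (n) in
/-- The number of distinct eigenvalues of `A` at `x`. -/
def numEigen (x : M) : ℕ :=
  Set.ncard {μ : ℝ | ∃ v : Tan n x, v ≠ 0 ∧ ∀ w, schoutenA x v w = μ * metric x v w}

variable (n M) in
/-- The set `M_A` of points near which the number of distinct eigenvalues of `A` is constant. -/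
def regularSet : Set M :=
  {x | ∀ᶠ y in 𝓝 x, numEigen n y = numEigen n x}

end Geometry

/-- `e 0, …, e 3` is an adapted frame field on the open set `U ⊆ M_A ∩ {∇f ≠ 0}` of a
4-dimensional `(M,g,f)`, with Ricci eigenfunctions `ev 0, …, ev 3`. -/
structure IsAdaptedFrame {M : Type*} [TopologicalSpace M]
    [ChartedSpace (EuclideanSpace ℝ (Fin 4)) M] [IsManifold (𝓡 4) ∞ M]
    [RiemannianBundle (fun x : M => TangentSpace (𝓡 4) x)]
    (f : M → ℝ) (U : Set M) (e : Fin 4 → ∀ x : M, Tan 4 x) (ev : Fin 4 → M → ℝ) : Prop where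
  isOpen : IsOpen U
  subset : U ⊆ regularSet 4 M ∩ {x | grad (n := 4) f x ≠ 0}
  smooth : ∀ i, SmoothFieldOn (e i) U
  orthonormal : ∀ x ∈ U, ∀ i j, metric x (e i x) (e j x) = if i = j then 1 else 0
  eigen : ∀ x ∈ U, ∀ i, ∀ w : Tan 4 x, ricci x (e i x) w = ev i x * metric x (e i x) w
  /-- `E₁ = ∇f / |∇f|` -/
  first : ∀ x ∈ U, e 0 x = (Real.sqrt (metric x (grad (n := 4) f x) (grad f x)))⁻¹ • grad (n := 4) f x
  /-- The other fields are tangent to the level hypersurfaces of `f`. -/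
  tangent : ∀ x ∈ U, ∀ i, i ≠ 0 → dirDeriv f x (e i x) = 0
  /-- The frame lists bases of the eigenspace distributions `D₁, …, D_k` of `A` on `U` one after
  the other: `d i` is the index of the distribution that contains `e i` (the eigenvalue of `A` on
  `e i` is `ev i - R/6`, so two of the fields lie in the same eigenspace of `A` exactly when their
  Ricci eigenvalues agree). -/
  blocks : ∃ (k : ℕ) (d : Fin 4 → Fin k), Monotone d ∧ Function.Surjective d ∧
    ∀ x ∈ U, ∀ i j, ev i x = ev j x ↔ d i = d j

end Soliton

end

noncomputable section

namespace Soliton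

set_option linter.unusedSectionVars false

/-! Suppose the three tangential Ricci eigenvalues differ; by the block structure of an adapted
frame they then differ at every point of `U`. Number the frame from 0, so that `e 0` is normal to
the level sets of `f`, and put `p = |∇f|`. The soliton equation makes `e 1`, `e 2`, `e 3` principal
directions of the level sets, with principal curvatures `a`, `b`, `c` given by `p * a = lam - ev 1`
and so on; these are distinct as well. Since `δW = 0`, the tensor `Ric - R/6 g` is Codazzi
(`FrameAlg.codazzi`). Its components show that `R` and `ev 0` are constant along level sets, that
the frame is parallel along `∇f`, and that the three radial sectional curvatures agree. Hence `a`,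
`b`, `c` solve one and the same Riccati equation `3 (a' + a²) = -ev 0` (`SolitonAlg.riccati`), the
prime denoting `e 0`.

The trace `a + b + c` is constant on level sets. Differentiating it along `e 0` gives the same for
the second and third power sums, and a Vandermonde argument then makes `a`, `b`, `c` themselves
constant there (`SolitonAlg.E_Γ`). The Codazzi equation now kills every tangential connection
coefficient with a repeated index. The survivors `u = Γ 1 2 3`, `v = Γ 2 3 1`, `w = Γ 3 1 2` satisfy
`u (b - c) = v (c - a) = w (a - b)`. Eliminating them from the three tangential Ricci equations
leaves one cubic relation and one trace relation between `a`, `b`, `c`, `p`, `ev 0` and `lam`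
(`curvature_relation_cubic`, `curvature_relation_trace`).

Differentiating these relations repeatedly along `e 0` forces `2 (a + b + c) = 5 p` and finally the
vanishing of the discriminant of `a`, `b`, `c`, which contradicts their distinctness
(`level_set_ode_false`).

Everything after the passage to a frame is differential algebra. It is therefore carried out in an
abstract commutative real algebra with four derivations (`FrameAlg`, `SolitonAlg`), where identities
reduce to polynomial ones; the geometric work consists in showing that the smooth functions on `U`
form such a model. -/

lemma isManifold_minSmoothness_three {n : ℕ} {M : Type*} [TopologicalSpace M]
    [ChartedSpace (EuclideanSpace ℝ (Fin n)) M] [IsManifold (𝓡 n) ∞ M] :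
    IsManifold (𝓡 n) (minSmoothness ℝ 3) M := by
  rw [minSmoothness_of_isRCLikeNormedField]; infer_instance

lemma isManifold_minSmoothness_two {n : ℕ} {M : Type*} [TopologicalSpace M]
    [ChartedSpace (EuclideanSpace ℝ (Fin n)) M] [IsManifold (𝓡 n) ∞ M] :
    IsManifold (𝓡 n) (minSmoothness ℝ 2) M := by
  rw [minSmoothness_of_isRCLikeNormedField]; infer_instance

attribute [local instance] isManifold_minSmoothness_three isManifold_minSmoothness_two

/-! ### Directional derivatives, smooth fields and local extensions of vectors. -/

section Basic

variable {n : ℕ} {M : Type*} [TopologicalSpace M] [ChartedSpace (EuclideanSpace ℝ (Fin n)) M]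
  [IsManifold (𝓡 n) ∞ M]

/-- The function `φ` is smooth on the set `U`. -/
abbrev SmoothOn (n : ℕ) {M : Type*} [TopologicalSpace M]
    [ChartedSpace (EuclideanSpace ℝ (Fin n)) M] (φ : M → ℝ) (U : Set M) : Prop :=
  ContMDiffOn (𝓡 n) 𝓘(ℝ, ℝ) ∞ φ U

/-- The vector field `V` is differentiable at `x`. -/
abbrev DiffField (V : ∀ x : M, Tan n x) (x : M) : Prop :=
  MDifferentiableAt (𝓡 n) (𝓡 n).tangent (fun x => (⟨x, V x⟩ : TangentBundle (𝓡 n) M)) x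

/-- The function `φ` is differentiable at `x`. -/
abbrev DiffFun (n : ℕ) {M : Type*} [TopologicalSpace M]
    [ChartedSpace (EuclideanSpace ℝ (Fin n)) M] (φ : M → ℝ) (x : M) : Prop :=
  MDifferentiableAt (𝓡 n) 𝓘(ℝ, ℝ) φ x

lemma SmoothOn.diffFun {φ : M → ℝ} {U : Set M} (h : SmoothOn n φ U) (hU : IsOpen U) {x : M}
    (hx : x ∈ U) : DiffFun n φ x :=
  (h.contMDiffAt (hU.mem_nhds hx)).mdifferentiableAt (by simp)

lemma SmoothFieldOn.diffField {V : ∀ x : M, Tan n x} {U : Set M} (h : SmoothFieldOn V U)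
    (hU : IsOpen U) {x : M} (hx : x ∈ U) : DiffField V x :=
  (ContMDiffOn.contMDiffAt h (hU.mem_nhds hx)).mdifferentiableAt (by simp)

lemma dirDeriv_add {φ ψ : M → ℝ} {x : M} (hφ : DiffFun n φ x) (hψ : DiffFun n ψ x)
    (v : Tan n x) : dirDeriv (fun y => φ y + ψ y) x v = dirDeriv φ x v + dirDeriv ψ x v := by
  unfold dirDeriv
  rw [mvfderiv_fun_add hφ hψ]; rfl

lemma dirDeriv_mul {φ ψ : M → ℝ} {x : M} (hφ : DiffFun n φ x) (hψ : DiffFun n ψ x)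
    (v : Tan n x) :
    dirDeriv (fun y => φ y * ψ y) x v = φ x * dirDeriv ψ x v + ψ x * dirDeriv φ x v := by
  unfold dirDeriv
  rw [mvfderiv_fun_mul hφ hψ]; rfl

lemma dirDeriv_const (c : ℝ) (x : M) (v : Tan n x) : dirDeriv (fun _ : M => c) x v = 0 := by
  unfold dirDeriv
  rw [mvfderiv_const]; rfl

lemma dirDeriv_congr {φ ψ : M → ℝ} {x : M} (h : φ =ᶠ[𝓝 x] ψ) (v : Tan n x) :
    dirDeriv φ x v = dirDeriv ψ x v := by
  unfold dirDeriv mvfderiv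
  have := h.mfderiv_eq (I := 𝓡 n) (I' := 𝓘(ℝ, ℝ))
  simp only [ContinuousLinearMap.comp_apply]
  rw [this]; rfl

lemma dirDeriv_add_right (φ : M → ℝ) (x : M) (v w : Tan n x) :
    dirDeriv φ x (v + w) = dirDeriv φ x v + dirDeriv φ x w :=
  map_add _ _ _

lemma dirDeriv_smul_right (φ : M → ℝ) (x : M) (c : ℝ) (v : Tan n x) :
    dirDeriv φ x (c • v) = c * dirDeriv φ x v :=
  map_smul _ _ _

lemma dirDeriv_sum_right (φ : M → ℝ) (x : M) {ι : Type*} (s : Finset ι) (v : ι → Tan n x) :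
    dirDeriv φ x (∑ i ∈ s, v i) = ∑ i ∈ s, dirDeriv φ x (v i) :=
  map_sum (mvfderiv (𝓡 n) φ x) _ _

lemma smoothOn_dirDeriv {φ : M → ℝ} {X : ∀ x : M, Tan n x} {U : Set M} (hU : IsOpen U)
    (hφ : SmoothOn n φ U) (hX : SmoothFieldOn X U) :
    SmoothOn n (fun y => dirDeriv φ y (X y)) U := by
  have h1 : ContMDiffOn (𝓡 n).tangent 𝓘(ℝ, ℝ).tangent ∞ (tangentMapWithin (𝓡 n) 𝓘(ℝ, ℝ) φ U)
      (Bundle.TotalSpace.proj ⁻¹' U) :=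
    hφ.contMDiffOn_tangentMapWithin (by simp) hU.uniqueMDiffOn
  have h2 := h1.comp hX (fun x hx => hx)
  intro x hx
  have h3 := h2 x hx
  rw [contMDiffWithinAt_totalSpace] at h3
  refine (h3.2).congr_of_eventuallyEq ?_ ?_
  · filter_upwards [self_mem_nhdsWithin] with y hy
    simp [tangentMapWithin, dirDeriv, mvfderiv, mfderivWithin_of_isOpen hU hy]
    rfl
  · simp [tangentMapWithin, dirDeriv, mvfderiv, mfderivWithin_of_isOpen hU hx]
    rfl

lemma extField_self {x : M} (v : Tan n x) : extField v x = v :=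
  FiberBundle.extend_apply_self _ _

lemma exists_smoothFieldOn_extField {x : M} (v : Tan n x) :
    ∃ s : Set M, IsOpen s ∧ x ∈ s ∧ SmoothFieldOn (extField v) s := by
  obtain ⟨s, hs, h⟩ := FiberBundle.exists_contMDiffOn_extend (k := ∞) (𝓡 n) (EuclideanSpace ℝ (Fin n))
    (V := fun y : M => TangentSpace (𝓡 n) y) v
  obtain ⟨t, hts, ht, hxt⟩ := mem_nhds_iff.1 hs
  exact ⟨t, ht, hxt, h.mono hts⟩

lemma diffField_extField {x : M} (v : Tan n x) : DiffField (extField v) x := by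
  obtain ⟨s, hs, hx, h⟩ := exists_smoothFieldOn_extField v
  exact h.diffField hs hx

end Basic

/-! ### The Lie bracket as a commutator, and the Levi-Civita connection. -/

section Connection

variable {n : ℕ} {M : Type*} [TopologicalSpace M] [ChartedSpace (EuclideanSpace ℝ (Fin n)) M]
  [IsManifold (𝓡 n) ∞ M]

lemma DiffField.add {X Y : ∀ x : M, Tan n x} {x : M} (hX : DiffField X x) (hY : DiffField Y x) :
    DiffField (X + Y) x :=
  mdifferentiableAt_add_section hX hY

lemma DiffField.smul {φ : M → ℝ} {X : ∀ x : M, Tan n x} {x : M} (hφ : DiffFun n φ x)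
    (hX : DiffField X x) : DiffField (φ • X) x :=
  MDifferentiableAt.smul_section hφ hX

lemma SmoothFieldOn.smul {φ : M → ℝ} {X : ∀ x : M, Tan n x} {U : Set M} (hφ : SmoothOn n φ U)
    (hX : SmoothFieldOn X U) : SmoothFieldOn (φ • X) U :=
  ContMDiffOn.smul_section hφ hX

lemma SmoothFieldOn.sum {ι : Type*} (s : Finset ι) {X : ι → ∀ x : M, Tan n x} {U : Set M}
    (hX : ∀ i, SmoothFieldOn (X i) U) : SmoothFieldOn (fun x => ∑ i ∈ s, X i x) U :=
  ContMDiffOn.sum_section (fun i _ => hX i)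

lemma SmoothFieldOn.congr {X Y : ∀ x : M, Tan n x} {U : Set M} (hX : SmoothFieldOn X U)
    (h : ∀ x ∈ U, Y x = X x) : SmoothFieldOn Y U :=
  ContMDiffOn.congr hX (fun x hx => by rw [h x hx])

lemma SmoothFieldOn.mlieBracket {X Y : ∀ x : M, Tan n x} {U : Set M} (hU : IsOpen U)
    (hX : SmoothFieldOn X U) (hY : SmoothFieldOn Y U) :
    SmoothFieldOn (VectorField.mlieBracket (𝓡 n) X Y) U := by
  have : IsManifold (𝓡 n) (((⊤ : ℕ∞) : WithTop ℕ∞) + 1) M := by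
    change IsManifold (𝓡 n) ∞ M; infer_instance
  intro x hx
  refine ContMDiffAt.contMDiffWithinAt ?_
  exact ContMDiffAt.mlieBracket_vectorField (m := ⊤) (n := ⊤)
    (ContMDiffOn.contMDiffAt hX (hU.mem_nhds hx)) (ContMDiffOn.contMDiffAt hY (hU.mem_nhds hx))
    (by rw [minSmoothness_of_isRCLikeNormedField]; exact le_rfl)

/-- The bracket of vector fields is the commutator of the associated derivations. -/
lemma dirDeriv_mlieBracket {φ : M → ℝ} {X Y Z : ∀ x : M, Tan n x} {U : Set M} (hU : IsOpen U)
    (hφ : SmoothOn n φ U) (hX : SmoothFieldOn X U) (hY : SmoothFieldOn Y U)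
    (hZ : SmoothFieldOn Z U) {x : M} (hx : x ∈ U) (hZx : Z x ≠ 0) :
    dirDeriv φ x (VectorField.mlieBracket (𝓡 n) X Y x)
      = dirDeriv (fun y => dirDeriv φ y (Y y)) x (X x)
        - dirDeriv (fun y => dirDeriv φ y (X y)) x (Y x) := by
  -- The Jacobi identity is compared for `φ • Z` and for `Z`: after expansion by the Leibniz rule
  -- everything cancels except a multiple of `Z x`, whose coefficient is the wanted difference. This
  -- is why a field not vanishing at `x` is needed.
  have jac : ∀ W : ∀ x : M, Tan n x, SmoothFieldOn W U →
      VectorField.mlieBracket (𝓡 n) X (VectorField.mlieBracket (𝓡 n) Y W) x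
      = VectorField.mlieBracket (𝓡 n) (VectorField.mlieBracket (𝓡 n) X Y) W x
        + VectorField.mlieBracket (𝓡 n) Y (VectorField.mlieBracket (𝓡 n) X W) x := by
    intro W hW
    have aux : ∀ V : ∀ x : M, Tan n x, SmoothFieldOn V U →
        ContMDiffAt (𝓡 n) (𝓡 n).tangent (minSmoothness ℝ 2)
          (fun x => (⟨x, V x⟩ : TangentBundle (𝓡 n) M)) x := by
      intro V hV
      refine (ContMDiffOn.contMDiffAt hV (hU.mem_nhds hx)).of_le ?_
      rw [minSmoothness_of_isRCLikeNormedField]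
      exact ENat.LEInfty.out
    exact VectorField.leibniz_identity_mlieBracket_apply (aux X hX) (aux Y hY) (aux W hW)
  have key : ∀ A B : ∀ x : M, Tan n x, SmoothFieldOn A U → SmoothFieldOn B U →
      VectorField.mlieBracket (𝓡 n) A (VectorField.mlieBracket (𝓡 n) B (φ • Z)) x
      = dirDeriv (fun y => dirDeriv φ y (B y)) x (A x) • Z x
        + dirDeriv φ x (B x) • VectorField.mlieBracket (𝓡 n) A Z x
        + (dirDeriv φ x (A x) • VectorField.mlieBracket (𝓡 n) B Z x
        + φ x • VectorField.mlieBracket (𝓡 n) A (VectorField.mlieBracket (𝓡 n) B Z) x) := by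
    intro A B hA hB
    have e1 : VectorField.mlieBracket (𝓡 n) B (φ • Z) =ᶠ[𝓝 x]
        ((fun y => dirDeriv φ y (B y)) • Z + φ • VectorField.mlieBracket (𝓡 n) B Z :
          ∀ x : M, Tan n x) := by
      filter_upwards [hU.mem_nhds hx] with y hy
      exact VectorField.mlieBracket_smul_right (hφ.diffFun hU hy) (hZ.diffField hU hy)
    rw [Filter.EventuallyEq.mlieBracket_vectorField_eq (EventuallyEq.refl _ A) e1]
    have hd := (smoothOn_dirDeriv hU hφ hB).diffFun hU hx
    have hBZ := (SmoothFieldOn.mlieBracket hU hB hZ).diffField hU hx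
    have hφx := hφ.diffFun hU hx
    have hZd := hZ.diffField hU hx
    rw [VectorField.mlieBracket_add_right (DiffField.smul hd hZd) (DiffField.smul hφx hBZ),
      VectorField.mlieBracket_smul_right hd hZd, VectorField.mlieBracket_smul_right hφx hBZ]
    rfl
  have j1 := jac (φ • Z) (hZ.smul hφ)
  have j2 := jac Z hZ
  rw [key X Y hX hY, key Y X hY hX, VectorField.mlieBracket_smul_right (hφ.diffFun hU hx)
    (hZ.diffField hU hx), j2] at j1
  have j3 : (dirDeriv φ x (VectorField.mlieBracket (𝓡 n) X Y x)
      - (dirDeriv (fun y => dirDeriv φ y (Y y)) x (X x)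
        - dirDeriv (fun y => dirDeriv φ y (X y)) x (Y x))) • Z x = 0 := by
    change _ = (dirDeriv φ x _ • Z x + _) + _ at j1
    rw [sub_smul, sub_smul]
    simp only [smul_add] at j1
    have := sub_eq_zero.2 j1
    rw [← neg_eq_zero, ← this]
    abel
  exact sub_eq_zero.1 ((smul_eq_zero.1 j3).resolve_right hZx)

variable [RiemannianBundle (fun x : M => TangentSpace (𝓡 n) x)]

lemma metric_comm (x : M) (v w : Tan n x) : metric x v w = metric x w v :=
  real_inner_comm _ _

lemma metric_add_left (x : M) (u v w : Tan n x) :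
    metric x (u + v) w = metric x u w + metric x v w :=
  inner_add_left _ _ _

lemma metric_add_right (x : M) (u v w : Tan n x) :
    metric x u (v + w) = metric x u v + metric x u w :=
  inner_add_right _ _ _

lemma metric_sub_left (x : M) (u v w : Tan n x) :
    metric x (u - v) w = metric x u w - metric x v w :=
  inner_sub_left _ _ _

lemma metric_neg_left (x : M) (u w : Tan n x) : metric x (-u) w = -metric x u w :=
  inner_neg_left _ _

lemma metric_smul_left (x : M) (c : ℝ) (v w : Tan n x) :
    metric x (c • v) w = c * metric x v w :=
  real_inner_smul_left _ _ _

lemma metric_smul_right (x : M) (c : ℝ) (v w : Tan n x) :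
    metric x v (c • w) = c * metric x v w :=
  real_inner_smul_right _ _ _

lemma metric_sum_left (x : M) {ι : Type*} (s : Finset ι) (v : ι → Tan n x) (w : Tan n x) :
    metric x (∑ i ∈ s, v i) w = ∑ i ∈ s, metric x (v i) w :=
  sum_inner _ _ _

variable [IsContMDiffRiemannianBundle (𝓡 n) ∞ (EuclideanSpace ℝ (Fin n))
      (fun x : M => TangentSpace (𝓡 n) x)]

lemma diffFun_metric {X Y : ∀ x : M, Tan n x} {x : M} (hX : DiffField X x) (hY : DiffField Y x) :
    DiffFun n (fun y => metric y (X y) (Y y)) x :=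
  have : IsContMDiffRiemannianBundle (𝓡 n) 1 (EuclideanSpace ℝ (Fin n))
      (fun x : M => TangentSpace (𝓡 n) x) :=
    IsContMDiffRiemannianBundle.of_le (n := ∞) ENat.LEInfty.out
  MDifferentiableAt.inner_bundle (E := fun x : M => TangentSpace (𝓡 n) x)
    (b := fun y : M => y) hX hY

lemma smoothOn_metric {X Y : ∀ x : M, Tan n x} {U : Set M} (hX : SmoothFieldOn X U)
    (hY : SmoothFieldOn Y U) : SmoothOn n (fun y => metric y (X y) (Y y)) U :=
  ContMDiffOn.inner_bundle (E := fun x : M => TangentSpace (𝓡 n) x)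
    (b := fun y : M => y) hX hY

lemma dirDeriv_metric_smul_left {φ : M → ℝ} {X Y : ∀ x : M, Tan n x} {x : M}
    (hφ : DiffFun n φ x) (hX : DiffField X x) (hY : DiffField Y x) (v : Tan n x) :
    dirDeriv (fun y => metric y ((φ • X) y) (Y y)) x v
      = φ x * dirDeriv (fun y => metric y (X y) (Y y)) x v + metric x (X x) (Y x) * dirDeriv φ x v := by
  rw [← dirDeriv_mul hφ (diffFun_metric hX hY)]
  simp only [← metric_smul_left]; rfl

lemma dirDeriv_metric_smul_right {φ : M → ℝ} {X Y : ∀ x : M, Tan n x} {x : M}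
    (hφ : DiffFun n φ x) (hX : DiffField X x) (hY : DiffField Y x) (v : Tan n x) :
    dirDeriv (fun y => metric y (X y) ((φ • Y) y)) x v
      = φ x * dirDeriv (fun y => metric y (X y) (Y y)) x v + metric x (X x) (Y x) * dirDeriv φ x v := by
  rw [← dirDeriv_mul hφ (diffFun_metric hX hY)]
  simp only [← metric_smul_right]; rfl

lemma dirDeriv_metric_add_left {X X' Y : ∀ x : M, Tan n x} {x : M}
    (hX : DiffField X x) (hX' : DiffField X' x) (hY : DiffField Y x) (v : Tan n x) :
    dirDeriv (fun y => metric y ((X + X') y) (Y y)) x v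
      = dirDeriv (fun y => metric y (X y) (Y y)) x v
        + dirDeriv (fun y => metric y (X' y) (Y y)) x v := by
  rw [← dirDeriv_add (diffFun_metric hX hY) (diffFun_metric hX' hY)]
  simp only [← metric_add_left]; rfl

lemma dirDeriv_metric_add_right {X Y Y' : ∀ x : M, Tan n x} {x : M}
    (hX : DiffField X x) (hY : DiffField Y x) (hY' : DiffField Y' x) (v : Tan n x) :
    dirDeriv (fun y => metric y (X y) ((Y + Y') y)) x v
      = dirDeriv (fun y => metric y (X y) (Y y)) x v
        + dirDeriv (fun y => metric y (X y) (Y' y)) x v := by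
  rw [← dirDeriv_add (diffFun_metric hX hY) (diffFun_metric hX hY')]
  simp only [← metric_add_right]; rfl

lemma mlieBracket_smul_right' {φ : M → ℝ} {X Y : ∀ x : M, Tan n x} {x : M}
    (hφ : DiffFun n φ x) (hY : DiffField Y x) :
    VectorField.mlieBracket (𝓡 n) X (φ • Y) x
      = dirDeriv φ x (X x) • Y x + φ x • VectorField.mlieBracket (𝓡 n) X Y x :=
  VectorField.mlieBracket_smul_right hφ hY

lemma mlieBracket_smul_left' {φ : M → ℝ} {X Y : ∀ x : M, Tan n x} {x : M}
    (hφ : DiffFun n φ x) (hX : DiffField X x) :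
    VectorField.mlieBracket (𝓡 n) (φ • X) Y x
      = (-dirDeriv φ x (Y x)) • X x + φ x • VectorField.mlieBracket (𝓡 n) X Y x :=
  VectorField.mlieBracket_smul_left hφ hX

/-- The derivatives of `φ` produced by the metric terms cancel those produced by the brackets.
Together with additivity this gives tensoriality, so that the arbitrary extensions in `covAt` do not
matter. -/
lemma koszul_smul_left {φ : M → ℝ} {X Y Z : ∀ x : M, Tan n x} {x : M} (hφ : DiffFun n φ x)
    (hX : DiffField X x) (hY : DiffField Y x) (hZ : DiffField Z x) :
    koszul (φ • X) Y Z x = φ x * koszul X Y Z x := by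
  have e : (φ • X) x = φ x • X x := rfl
  unfold koszul
  rw [dirDeriv_metric_smul_left hφ hX hZ, dirDeriv_metric_smul_left hφ hX hY,
    mlieBracket_smul_left' hφ hX, mlieBracket_smul_left' hφ hX, e, dirDeriv_smul_right]
  simp only [metric_add_left, metric_smul_left, metric_smul_right]
  ring

lemma koszul_smul_right {φ : M → ℝ} {X Y Z : ∀ x : M, Tan n x} {x : M} (hφ : DiffFun n φ x)
    (hX : DiffField X x) (hY : DiffField Y x) (hZ : DiffField Z x) :
    koszul X Y (φ • Z) x = φ x * koszul X Y Z x := by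
  have e : (φ • Z) x = φ x • Z x := rfl
  unfold koszul
  rw [dirDeriv_metric_smul_right hφ hY hZ, dirDeriv_metric_smul_right hφ hX hZ,
    mlieBracket_smul_right' hφ hZ, mlieBracket_smul_right' hφ hZ, e, dirDeriv_smul_right]
  simp only [metric_add_left, metric_smul_left, metric_smul_right]
  rw [metric_comm x (Z x) (Y x), metric_comm x (Z x) (X x)]
  ring

lemma koszul_add_left {X X' Y Z : ∀ x : M, Tan n x} {x : M} (hX : DiffField X x)
    (hX' : DiffField X' x) (hY : DiffField Y x) (hZ : DiffField Z x) :
    koszul (X + X') Y Z x = koszul X Y Z x + koszul X' Y Z x := by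
  have e : (X + X') x = X x + X' x := rfl
  unfold koszul
  rw [dirDeriv_metric_add_left hX hX' hZ, dirDeriv_metric_add_left hX hX' hY,
    VectorField.mlieBracket_add_left hX hX', VectorField.mlieBracket_add_left hX hX', e,
    dirDeriv_add_right]
  simp only [metric_add_left, metric_add_right]
  ring

lemma koszul_add_right {X Y Z Z' : ∀ x : M, Tan n x} {x : M} (hX : DiffField X x)
    (hY : DiffField Y x) (hZ : DiffField Z x) (hZ' : DiffField Z' x) :
    koszul X Y (Z + Z') x = koszul X Y Z x + koszul X Y Z' x := by
  have e : (Z + Z') x = Z x + Z' x := rfl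
  unfold koszul
  rw [dirDeriv_metric_add_right hY hZ hZ', dirDeriv_metric_add_right hX hZ hZ',
    VectorField.mlieBracket_add_right hZ hZ', VectorField.mlieBracket_add_right hZ hZ', e,
    dirDeriv_add_right]
  simp only [metric_add_left, metric_add_right]
  ring

/-- The Koszul expression depends on its first argument through the value at `x` only. -/
lemma koszul_congr_left {X X' Y Z : ∀ x : M, Tan n x} {x : M} (hX : DiffField X x)
    (hX' : DiffField X' x) (hY : DiffField Y x) (hZ : DiffField Z x) (h : X x = X' x) :
    koszul X Y Z x = koszul X' Y Z x := by
  have : TensorialAt (𝓡 n) (EuclideanSpace ℝ (Fin n)) (V := fun x : M => TangentSpace (𝓡 n) x)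
      (fun X => koszul X Y Z x) x :=
    ⟨fun hφ hσ => koszul_smul_left hφ hσ hY hZ, fun h1 h2 => koszul_add_left h1 h2 hY hZ⟩
  exact this.pointwise hX hX' h

/-- The Koszul expression depends on its last argument through the value at `x` only. -/
lemma koszul_congr_right {X Y Z Z' : ∀ x : M, Tan n x} {x : M} (hX : DiffField X x)
    (hY : DiffField Y x) (hZ : DiffField Z x) (hZ' : DiffField Z' x) (h : Z x = Z' x) :
    koszul X Y Z x = koszul X Y Z' x := by
  have : TensorialAt (𝓡 n) (EuclideanSpace ℝ (Fin n)) (V := fun x : M => TangentSpace (𝓡 n) x)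
      (fun Z => koszul X Y Z x) x :=
    ⟨fun hφ hσ => koszul_smul_right hφ hX hY hσ, fun h1 h2 => koszul_add_right hX hY h1 h2⟩
  exact this.pointwise hZ hZ' h

lemma eq_of_metric_eq {x : M} {v w : Tan n x} (h : ∀ z, metric x v z = metric x w z) : v = w :=
  ext_inner_right ℝ h

/-- Riesz representation of a linear functional; it serves both the connection, defined through the
Koszul expression, and the gradient. -/
lemma metric_extend_sum {x : M} {Φ : Tan n x → ℝ} (hadd : ∀ v w, Φ (v + w) = Φ v + Φ w)
    (hsmul : ∀ (c : ℝ) v, Φ (c • v) = c * Φ v) (z : Tan n x) :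
    metric x (∑ i, Φ (onb x i) • onb x i) z = Φ z := by
  let L : Tan n x →ₗ[ℝ] ℝ := { toFun := Φ, map_add' := hadd, map_smul' := hsmul }
  have hz : z = ∑ i, metric x (onb x i) z • onb x i :=
    ((onb x).sum_repr' z).symm
  conv_rhs => rw [hz]
  change _ = L _
  rw [map_sum, metric_sum_left]
  refine Finset.sum_congr rfl fun i _ => ?_
  rw [metric_smul_left, map_smul, smul_eq_mul, mul_comm]
  rfl

/-- The Koszul formula. -/
lemma metric_covAt {X Y Z : ∀ x : M, Tan n x} {x : M} (hX : DiffField X x)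
    (hY : DiffField Y x) (hZ : DiffField Z x) :
    metric x (covAt x (X x) Y) (Z x) = koszul X Y Z x / 2 := by
  have h := metric_extend_sum (x := x)
    (Φ := fun v => koszul (extField (X x)) Y (extField v) x / 2) ?_ ?_ (Z x)
  · rw [koszul_congr_right (diffField_extField _) hY (diffField_extField _) hZ (extField_self _),
      koszul_congr_left (diffField_extField _) hX hY hZ (extField_self _)] at h
    exact h
  · intro v w
    rw [koszul_congr_right (diffField_extField _) hY (diffField_extField (v + w))
      ((diffField_extField v).add (diffField_extField w))
      (by rw [Pi.add_apply, extField_self, extField_self, extField_self]),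
      koszul_add_right (diffField_extField _) hY (diffField_extField v) (diffField_extField w)]
    ring
  · intro c v
    have hc : DiffFun n (fun _ : M => c) x := mdifferentiableAt_const
    rw [koszul_congr_right (diffField_extField _) hY (diffField_extField (c • v))
      (DiffField.smul hc (diffField_extField v))
      (by rw [Pi.smul_apply', extField_self, extField_self]),
      koszul_smul_right hc (diffField_extField _) hY (diffField_extField v)]
    ring

lemma metric_covAt_extField {Y : ∀ x : M, Tan n x} {x : M} (hY : DiffField Y x) (v z : Tan n x) :
    metric x (covAt x v Y) z = koszul (extField v) Y (extField z) x / 2 := by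
  have := metric_covAt (diffField_extField v) hY (diffField_extField z)
  rwa [extField_self, extField_self] at this

lemma covAt_add_left {Y : ∀ x : M, Tan n x} {x : M} (hY : DiffField Y x) (v w : Tan n x) :
    covAt x (v + w) Y = covAt x v Y + covAt x w Y := by
  refine eq_of_metric_eq fun z => ?_
  rw [metric_add_left, metric_covAt_extField hY, metric_covAt_extField hY, metric_covAt_extField hY,
    koszul_congr_left (diffField_extField (v + w))
      ((diffField_extField v).add (diffField_extField w)) hY (diffField_extField z)
      (by rw [Pi.add_apply, extField_self, extField_self, extField_self]),
    koszul_add_left (diffField_extField v) (diffField_extField w) hY (diffField_extField z)]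
  ring

lemma covAt_smul_left {Y : ∀ x : M, Tan n x} {x : M} (hY : DiffField Y x) (c : ℝ) (v : Tan n x) :
    covAt x (c • v) Y = c • covAt x v Y := by
  have hc : DiffFun n (fun _ : M => c) x := mdifferentiableAt_const
  refine eq_of_metric_eq fun z => ?_
  rw [metric_smul_left, metric_covAt_extField hY, metric_covAt_extField hY,
    koszul_congr_left (diffField_extField (c • v))
      (DiffField.smul hc (diffField_extField v)) hY (diffField_extField z)
      (by rw [Pi.smul_apply', extField_self, extField_self]),
    koszul_smul_left hc (diffField_extField v) hY (diffField_extField z)]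
  ring

/-- The Levi-Civita connection is torsion-free. -/
lemma covAt_sub_covAt {X Y : ∀ x : M, Tan n x} {x : M} (hX : DiffField X x) (hY : DiffField Y x) :
    covAt x (X x) Y - covAt x (Y x) X = VectorField.mlieBracket (𝓡 n) X Y x := by
  refine eq_of_metric_eq fun z => ?_
  have hz := diffField_extField z
  have h1 := metric_covAt hX hY hz
  have h2 := metric_covAt hY hX hz
  rw [extField_self] at h1 h2
  rw [metric_sub_left, h1, h2]
  have e : (fun y => metric y (Y y) (X y)) = fun y => metric y (X y) (Y y) := by
    funext y; exact metric_comm _ _ _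
  unfold koszul
  rw [VectorField.mlieBracket_swap_apply (V := Y) (W := X), metric_neg_left, extField_self, e]
  ring

/-- The Levi-Civita connection is compatible with the metric. -/
lemma dirDeriv_metric {Y Z : ∀ x : M, Tan n x} {x : M} (hY : DiffField Y x)
    (hZ : DiffField Z x) (v : Tan n x) :
    dirDeriv (fun y => metric y (Y y) (Z y)) x v
      = metric x (covAt x v Y) (Z x) + metric x (Y x) (covAt x v Z) := by
  have hv := diffField_extField v
  have h1 := metric_covAt hv hY hZ
  have h2 := metric_covAt hv hZ hY
  rw [extField_self] at h1 h2
  rw [metric_comm x (Y x), h1, h2]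
  have e : (fun y => metric y (Z y) (Y y)) = fun y => metric y (Y y) (Z y) := by
    funext y; exact metric_comm _ _ _
  unfold koszul
  rw [VectorField.mlieBracket_swap_apply (V := Z) (W := Y), metric_neg_left, extField_self, e]
  ring

end Connection

/-! ### Christoffel symbols and components of fields in a smooth orthonormal frame. -/

section Frame

variable {M : Type*} [TopologicalSpace M] [ChartedSpace (EuclideanSpace ℝ (Fin 4)) M]
  [IsManifold (𝓡 4) ∞ M] [RiemannianBundle (fun x : M => TangentSpace (𝓡 4) x)]

/-- `e 0, …, e 3` is a smooth orthonormal frame field on the open set `U`. -/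
structure IsOrthoFrame (U : Set M) (e : Fin 4 → ∀ x : M, Tan 4 x) : Prop where
  isOpen : IsOpen U
  smooth : ∀ i, SmoothFieldOn (e i) U
  orthonormal : ∀ x ∈ U, ∀ i j, metric x (e i x) (e j x) = if i = j then 1 else 0

/-- The Christoffel symbol `⟨∇_{eᵢ} eⱼ, eₖ⟩` of the frame `e`. -/
def christoffel (e : Fin 4 → ∀ x : M, Tan 4 x) (i j k : Fin 4) (x : M) : ℝ :=
  metric x (covAt x (e i x) (e j)) (e k x)

/-- The coefficient `⟨R(eᵢ,eⱼ)eₖ, eₗ⟩` of the curvature tensor in terms of Christoffel symbols. -/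
def frameRiem (e : Fin 4 → ∀ x : M, Tan 4 x) (i j k l : Fin 4) (x : M) : ℝ :=
  dirDeriv (christoffel e j k l) x (e i x) - dirDeriv (christoffel e i k l) x (e j x)
    + ∑ m, (christoffel e j k m x * christoffel e i m l x
        - christoffel e i k m x * christoffel e j m l x)
    - ∑ m, (christoffel e i j m x - christoffel e j i m x) * christoffel e m k l x

variable {U : Set M} {e : Fin 4 → ∀ x : M, Tan 4 x}

namespace IsOrthoFrame

/-- The orthonormal basis of the tangent space given by the frame. -/
def basisAt (hF : IsOrthoFrame U e) {x : M} (hx : x ∈ U) : OrthonormalBasis (Fin 4) ℝ (Tan 4 x) :=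
  have ho : Orthonormal ℝ (fun i => e i x) := orthonormal_iff_ite.2 (hF.orthonormal x hx)
  OrthonormalBasis.mk ho (by
    have hc : Fintype.card (Fin 4) = Module.finrank ℝ (Tan 4 x) := by
      change _ = Module.finrank ℝ (EuclideanSpace ℝ (Fin 4))
      simp
    rw [ho.linearIndependent.span_eq_top_of_card_eq_finrank' hc])

lemma basisAt_apply (hF : IsOrthoFrame U e) {x : M} (hx : x ∈ U) (i : Fin 4) :
    hF.basisAt hx i = e i x := by
  simp [basisAt]

lemma sum_metric_smul (hF : IsOrthoFrame U e) {x : M} (hx : x ∈ U) (v : Tan 4 x) :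
    ∑ i, metric x v (e i x) • e i x = v := by
  have := (hF.basisAt hx).sum_repr' v
  simp only [basisAt_apply] at this
  conv_rhs => rw [← this]
  exact Finset.sum_congr rfl fun i _ => by rw [metric_comm]; rfl

lemma metric_eq_sum (hF : IsOrthoFrame U e) {x : M} (hx : x ∈ U) (v w : Tan 4 x) :
    metric x v w = ∑ i, metric x v (e i x) * metric x w (e i x) := by
  conv_lhs => rw [← hF.sum_metric_smul hx v]
  rw [metric_sum_left]
  exact Finset.sum_congr rfl fun i _ => by rw [metric_smul_left, metric_comm x (e i x)]

lemma eq_of_metric_eq (hF : IsOrthoFrame U e) {x : M} (hx : x ∈ U) {v w : Tan 4 x}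
    (h : ∀ i, metric x v (e i x) = metric x w (e i x)) : v = w := by
  rw [← hF.sum_metric_smul hx v, ← hF.sum_metric_smul hx w]
  simp only [h]

/-- The trace of a bilinear form does not depend on the orthonormal basis. -/
lemma sum_onb_eq (hF : IsOrthoFrame U e) {x : M} (hx : x ∈ U)
    (T : Tan 4 x →ₗ[ℝ] Tan 4 x →ₗ[ℝ] ℝ) :
    ∑ a, T (onb x a) (onb x a) = ∑ i, T (e i x) (e i x) := by
  have h1 : ∀ a, T (onb x a) (onb x a) = ∑ i, ∑ j,
      metric x (onb x a) (e i x) * metric x (onb x a) (e j x) * T (e i x) (e j x) := by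
    intro a
    conv_lhs => rw [← hF.sum_metric_smul hx (onb x a)]
    simp only [map_sum, map_smul, LinearMap.sum_apply, LinearMap.smul_apply, smul_eq_mul,
      Finset.mul_sum]
    rw [Finset.sum_comm]
    exact Finset.sum_congr rfl fun i _ => Finset.sum_congr rfl fun j _ => by ring
  have h2 : ∀ i j, ∑ a, metric x (onb x a) (e i x) * metric x (onb x a) (e j x)
      = if i = j then 1 else 0 := by
    intro i j
    rw [← hF.orthonormal x hx i j]
    have := (onb x).sum_inner_mul_inner (e i x) (e j x)
    rw [metric, ← this]
    exact Finset.sum_congr rfl fun a _ => by rw [metric_comm x (onb x a) (e i x)]; rfl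
  simp only [h1]
  rw [Finset.sum_comm]
  refine Finset.sum_congr rfl fun i _ => ?_
  rw [Finset.sum_comm]
  simp only [← Finset.sum_mul, h2]
  simp

lemma diffField (hF : IsOrthoFrame U e) {x : M} (hx : x ∈ U) (i : Fin 4) : DiffField (e i) x :=
  (hF.smooth i).diffField hF.isOpen hx

lemma dirDeriv_eq_sum (hF : IsOrthoFrame U e) {x : M} (hx : x ∈ U) (φ : M → ℝ) (v : Tan 4 x) :
    dirDeriv φ x v = ∑ i, metric x v (e i x) * dirDeriv φ x (e i x) := by
  conv_lhs => rw [← hF.sum_metric_smul hx v]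
  rw [dirDeriv_sum_right]
  simp only [dirDeriv_smul_right]

variable [IsContMDiffRiemannianBundle (𝓡 4) ∞ (EuclideanSpace ℝ (Fin 4))
      (fun x : M => TangentSpace (𝓡 4) x)]

lemma covAt_eq_sum (hF : IsOrthoFrame U e) {x : M} (hx : x ∈ U) {Y : ∀ x : M, Tan 4 x}
    (hY : DiffField Y x) (v : Tan 4 x) :
    covAt x v Y = ∑ i, metric x v (e i x) • covAt x (e i x) Y := by
  have key : ∀ s : Finset (Fin 4), covAt x (∑ i ∈ s, metric x v (e i x) • e i x) Y
      = ∑ i ∈ s, metric x v (e i x) • covAt x (e i x) Y := by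
    intro s
    induction s using Finset.induction_on with
    | empty =>
      have := covAt_smul_left hY 0 v
      simpa using this
    | insert a s ha ih =>
      rw [Finset.sum_insert ha, Finset.sum_insert ha, covAt_add_left hY, covAt_smul_left hY, ih]
  conv_lhs => rw [← hF.sum_metric_smul hx v]
  exact key _

/-- Metric compatibility applied to the locally constant function `⟨eⱼ, eₖ⟩`. -/
lemma christoffel_antisymm (hF : IsOrthoFrame U e) {x : M} (hx : x ∈ U) (i j k : Fin 4) :
    christoffel e i j k x = -christoffel e i k j x := by
  have h := dirDeriv_metric (hF.diffField hx j) (hF.diffField hx k) (e i x)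
  rw [dirDeriv_congr (ψ := fun _ => if j = k then 1 else 0)
    (by filter_upwards [hF.isOpen.mem_nhds hx] with y hy using hF.orthonormal y hy j k),
    dirDeriv_const, metric_comm x (e j x)] at h
  unfold christoffel
  linarith

/-- The components of a covariant derivative in the frame. -/
lemma metric_covAt_frame (hF : IsOrthoFrame U e) {x : M} (hx : x ∈ U) {Y : ∀ x : M, Tan 4 x}
    (hY : DiffField Y x) (v : Tan 4 x) (l : Fin 4) :
    metric x (covAt x v Y) (e l x) = dirDeriv (fun y => metric y (Y y) (e l y)) x v
      + ∑ k, metric x (Y x) (e k x) * ∑ j, metric x v (e j x) * christoffel e j k l x := by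
  rw [dirDeriv_metric hY (hF.diffField hx l), hF.covAt_eq_sum hx (hF.diffField hx l),
    hF.metric_eq_sum hx (Y x)]
  simp only [metric_sum_left, metric_smul_left]
  rw [add_assoc, ← Finset.sum_add_distrib, left_eq_add]
  refine Finset.sum_eq_zero fun k _ => ?_
  rw [← mul_add, ← Finset.sum_add_distrib]
  refine mul_eq_zero_of_right _ (Finset.sum_eq_zero fun j _ => ?_)
  have := hF.christoffel_antisymm hx j k l
  rw [this, ← mul_add]
  exact mul_eq_zero_of_right _ (add_neg_cancel _)

/-- Covariant derivatives and gradients are defined through an orthonormal basis chosen separately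
at each point; their smoothness is recovered from their coefficients in the smooth frame. -/
lemma smoothFieldOn_of_metric (hF : IsOrthoFrame U e) {V : Set M} (hVU : V ⊆ U)
    {X : ∀ x : M, Tan 4 x} (h : ∀ i, SmoothOn 4 (fun y => metric y (X y) (e i y)) V) :
    SmoothFieldOn X V := by
  refine (SmoothFieldOn.sum Finset.univ
    (fun i => SmoothFieldOn.smul (h i) (ContMDiffOn.mono (hF.smooth i) hVU))).congr fun x hx => ?_
  exact (hF.sum_metric_smul (hVU hx) (X x)).symm

lemma smoothOn_koszul {V : Set M} (hV : IsOpen V) {X Y Z : ∀ x : M, Tan 4 x}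
    (hX : SmoothFieldOn X V) (hY : SmoothFieldOn Y V) (hZ : SmoothFieldOn Z V) :
    SmoothOn 4 (fun x => koszul X Y Z x) V := by
  unfold koszul
  refine ContMDiffOn.sub (ContMDiffOn.sub (ContMDiffOn.add (ContMDiffOn.sub (ContMDiffOn.add
    ?_ ?_) ?_) ?_) ?_) ?_
  · exact smoothOn_dirDeriv hV (smoothOn_metric hY hZ) hX
  · exact smoothOn_dirDeriv hV (smoothOn_metric hX hZ) hY
  · exact smoothOn_dirDeriv hV (smoothOn_metric hX hY) hZ
  · exact smoothOn_metric (hX.mlieBracket hV hY) hZ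
  · exact smoothOn_metric (hX.mlieBracket hV hZ) hY
  · exact smoothOn_metric (hY.mlieBracket hV hZ) hX

lemma smoothOn_metric_cov {V : Set M} (hV : IsOpen V) {X Y Z : ∀ x : M, Tan 4 x}
    (hX : SmoothFieldOn X V) (hY : SmoothFieldOn Y V) (hZ : SmoothFieldOn Z V) :
    SmoothOn 4 (fun x => metric x (covAt x (X x) Y) (Z x)) V := by
  have h : SmoothOn 4 (fun x => koszul X Y Z x * (1 / 2)) V :=
    (smoothOn_koszul hV hX hY hZ).mul contMDiffOn_const
  refine h.congr fun x hx => ?_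
  rw [metric_covAt (hX.diffField hV hx) (hY.diffField hV hx) (hZ.diffField hV hx)]
  ring

lemma smoothFieldOn_cov (hF : IsOrthoFrame U e) {V : Set M} (hV : IsOpen V) (hVU : V ⊆ U)
    {X Y : ∀ x : M, Tan 4 x} (hX : SmoothFieldOn X V) (hY : SmoothFieldOn Y V) :
    SmoothFieldOn (cov X Y) V :=
  hF.smoothFieldOn_of_metric hVU fun i =>
    smoothOn_metric_cov hV hX hY (ContMDiffOn.mono (hF.smooth i) hVU)

lemma smoothOn_christoffel (hF : IsOrthoFrame U e) (i j k : Fin 4) :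
    SmoothOn 4 (christoffel e i j k) U :=
  smoothOn_metric_cov hF.isOpen (hF.smooth i) (hF.smooth j) (hF.smooth k)

lemma ne_zero (hF : IsOrthoFrame U e) {x : M} (hx : x ∈ U) (i : Fin 4) : e i x ≠ 0 := by
  intro h
  have := hF.orthonormal x hx i i
  rw [h, metric, inner_zero_left] at this
  simp at this

/-- The components of a Lie bracket in the frame. -/
lemma metric_mlieBracket (hF : IsOrthoFrame U e) {x : M} (hx : x ∈ U) {X Y : ∀ x : M, Tan 4 x}
    (hX : DiffField X x) (hY : DiffField Y x) (l : Fin 4) :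
    metric x (VectorField.mlieBracket (𝓡 4) X Y x) (e l x)
      = dirDeriv (fun y => metric y (Y y) (e l y)) x (X x)
        - dirDeriv (fun y => metric y (X y) (e l y)) x (Y x)
        + ∑ k, ∑ j, metric x (X x) (e j x) * metric x (Y x) (e k x) *
            (christoffel e j k l x - christoffel e k j l x) := by
  rw [← covAt_sub_covAt hX hY, metric_sub_left, hF.metric_covAt_frame hx hY,
    hF.metric_covAt_frame hx hX]
  simp only [Fin.sum_univ_four]
  ring

end IsOrthoFrame

end Frame

/-! ### The curvature tensor in terms of Christoffel symbols. -/

section Curvature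

variable {M : Type*} [TopologicalSpace M] [ChartedSpace (EuclideanSpace ℝ (Fin 4)) M]
  [IsManifold (𝓡 4) ∞ M] [RiemannianBundle (fun x : M => TangentSpace (𝓡 4) x)]
  [IsContMDiffRiemannianBundle (𝓡 4) ∞ (EuclideanSpace ℝ (Fin 4))
      (fun x : M => TangentSpace (𝓡 4) x)]
  {U : Set M} {e : Fin 4 → ∀ x : M, Tan 4 x}

lemma DiffFun.sum {ι : Type*} (s : Finset ι) {φ : ι → M → ℝ} {x : M}
    (h : ∀ i, DiffFun 4 (φ i) x) : DiffFun 4 (fun y => ∑ i ∈ s, φ i y) x := by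
  classical
  induction s using Finset.induction_on with
  | empty => simpa using mdifferentiableAt_const
  | insert a s ha ih =>
    simp only [Finset.sum_insert ha]
    exact (h a).add ih

lemma dirDeriv_sum {ι : Type*} (s : Finset ι) {φ : ι → M → ℝ} {x : M}
    (h : ∀ i, DiffFun 4 (φ i) x) (v : Tan 4 x) :
    dirDeriv (fun y => ∑ i ∈ s, φ i y) x v = ∑ i ∈ s, dirDeriv (φ i) x v := by
  classical
  induction s using Finset.induction_on with
  | empty => simpa using dirDeriv_const 0 x v
  | insert a s ha ih =>
    simp only [Finset.sum_insert ha]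
    rw [dirDeriv_add (h a) (DiffFun.sum s h), ih]

namespace IsOrthoFrame

/-- The connection coefficients `⟨∇_X eₖ, eₗ⟩`. -/
def connForm (e : Fin 4 → ∀ x : M, Tan 4 x) (X : ∀ x : M, Tan 4 x) (k l : Fin 4) (x : M) : ℝ :=
  ∑ j, metric x (X x) (e j x) * christoffel e j k l x

lemma diffFun_coeff (hF : IsOrthoFrame U e) {x : M} (hx : x ∈ U) {X : ∀ x : M, Tan 4 x}
    (hX : DiffField X x) (j : Fin 4) : DiffFun 4 (fun y => metric y (X y) (e j y)) x :=
  diffFun_metric hX (hF.diffField hx j)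

lemma diffFun_christoffel (hF : IsOrthoFrame U e) {x : M} (hx : x ∈ U) (i j k : Fin 4) :
    DiffFun 4 (christoffel e i j k) x :=
  (hF.smoothOn_christoffel i j k).diffFun hF.isOpen hx

lemma diffFun_connForm (hF : IsOrthoFrame U e) {x : M} (hx : x ∈ U) {X : ∀ x : M, Tan 4 x}
    (hX : DiffField X x) (k l : Fin 4) : DiffFun 4 (connForm e X k l) x :=
  DiffFun.sum _ fun j => (hF.diffFun_coeff hx hX j).mul (hF.diffFun_christoffel hx j k l)

lemma dirDeriv_connForm (hF : IsOrthoFrame U e) {x : M} (hx : x ∈ U) {X : ∀ x : M, Tan 4 x}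
    (hX : DiffField X x) (k l : Fin 4) (v : Tan 4 x) :
    dirDeriv (connForm e X k l) x v
      = ∑ j, (metric x (X x) (e j x) * dirDeriv (christoffel e j k l) x v
        + christoffel e j k l x * dirDeriv (fun y => metric y (X y) (e j y)) x v) := by
  unfold connForm
  rw [dirDeriv_sum (φ := fun j y => metric y (X y) (e j y) * christoffel e j k l y) _
    fun j => (hF.diffFun_coeff hx hX j).mul (hF.diffFun_christoffel hx j k l)]
  exact Finset.sum_congr rfl fun j _ =>
    dirDeriv_mul (hF.diffFun_coeff hx hX j) (hF.diffFun_christoffel hx j k l) v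

/-- The components of a second covariant derivative in the frame. -/
lemma metric_cov_cov (hF : IsOrthoFrame U e) {V : Set M} (hV : IsOpen V) (hVU : V ⊆ U)
    {X Y Z : ∀ x : M, Tan 4 x} (hY : SmoothFieldOn Y V)
    (hZ : SmoothFieldOn Z V) {x : M} (hx : x ∈ V) (l : Fin 4) :
    metric x (cov X (cov Y Z) x) (e l x)
      = dirDeriv (fun y => dirDeriv (fun y => metric y (Z y) (e l y)) y (Y y)) x (X x)
        + ∑ k, (metric x (Z x) (e k x) * dirDeriv (connForm e Y k l) x (X x)
          + connForm e Y k l x * dirDeriv (fun y => metric y (Z y) (e k y)) x (X x))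
        + ∑ m, (dirDeriv (fun y => metric y (Z y) (e m y)) x (Y x)
          + ∑ k, metric x (Z x) (e k x) * connForm e Y k m x) * connForm e X m l x := by
  have hcov : ∀ y ∈ V, ∀ m, metric y (cov Y Z y) (e m y)
      = dirDeriv (fun y => metric y (Z y) (e m y)) y (Y y)
        + ∑ k, metric y (Z y) (e k y) * connForm e Y k m y := fun y hy m =>
    hF.metric_covAt_frame (hVU hy) (hZ.diffField hV hy) (Y y) m
  have hxU := hVU hx
  have hZd := hZ.diffField hV hx
  have hYd := hY.diffField hV hx
  have hdd : DiffFun 4 (fun y => dirDeriv (fun y => metric y (Z y) (e l y)) y (Y y)) x :=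
    (smoothOn_dirDeriv hV (smoothOn_metric hZ (ContMDiffOn.mono (hF.smooth l) hVU)) hY).diffFun
      hV hx
  have hmul : ∀ k, DiffFun 4 (fun y => metric y (Z y) (e k y) * connForm e Y k l y) x := fun k =>
    (hF.diffFun_coeff hxU hZd k).mul (hF.diffFun_connForm hxU hYd k l)
  change metric x (covAt x (X x) (cov Y Z)) (e l x) = _
  rw [hF.metric_covAt_frame hxU ((hF.smoothFieldOn_cov hV hVU hY hZ).diffField hV hx),
    dirDeriv_congr (by filter_upwards [hV.mem_nhds hx] with y hy using hcov y hy l),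
    dirDeriv_add hdd (DiffFun.sum _ hmul), dirDeriv_sum _ hmul]
  congr 1
  · congr 1
    exact Finset.sum_congr rfl fun k _ =>
      dirDeriv_mul (hF.diffFun_coeff hxU hZd k) (hF.diffFun_connForm hxU hYd k l) _
  · exact Finset.sum_congr rfl fun m _ => by rw [hcov x hx m]; rfl

/-- Second derivatives of the coefficients of `Z` cancel because the bracket is the commutator, and
their first derivatives cancel by symmetry in `X` and `Y`; what is left is linear in `Z` pointwise.
-/
lemma metric_curvField_connForm (hF : IsOrthoFrame U e) {V : Set M} (hV : IsOpen V) (hVU : V ⊆ U)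
    {X Y Z : ∀ x : M, Tan 4 x} (hX : SmoothFieldOn X V) (hY : SmoothFieldOn Y V)
    (hZ : SmoothFieldOn Z V) {x : M} (hx : x ∈ V) (l : Fin 4) :
    metric x (curvField X Y Z x) (e l x) = ∑ k, metric x (Z x) (e k x) *
      (dirDeriv (connForm e Y k l) x (X x) - dirDeriv (connForm e X k l) x (Y x)
        + ∑ m, (connForm e Y k m x * connForm e X m l x
          - connForm e X k m x * connForm e Y m l x)
        - connForm e (VectorField.mlieBracket (𝓡 4) X Y) k l x) := by
  have hxU := hVU hx
  have hZl := smoothOn_metric hZ (ContMDiffOn.mono (hF.smooth l) hVU)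
  have hcomm := dirDeriv_mlieBracket hV hZl hX hY (ContMDiffOn.mono (hF.smooth 0) hVU) hx
    (hF.ne_zero hxU 0)
  have h3 := hF.metric_covAt_frame hxU (hZ.diffField hV hx)
    (VectorField.mlieBracket (𝓡 4) X Y x) l
  unfold curvField
  rw [metric_sub_left, metric_sub_left, hF.metric_cov_cov hV hVU hY hZ hx,
    hF.metric_cov_cov hV hVU hX hZ hx]
  change _ - _ - metric x (covAt x _ Z) _ = _
  rw [h3, hcomm]
  change _ - _ - (_ + ∑ k, _ * connForm e (VectorField.mlieBracket (𝓡 4) X Y) k l x) = _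
  simp only [Fin.sum_univ_four]
  ring

/-- Cartan's structure equation: the derivatives of the coefficients of `X` and `Y` are absorbed by
the bracket term, so the curvature form is bilinear at each point. -/
lemma connForm_curvature (hF : IsOrthoFrame U e) {x : M} (hx : x ∈ U)
    {X Y : ∀ x : M, Tan 4 x} (hX : DiffField X x) (hY : DiffField Y x) (k l : Fin 4) :
    dirDeriv (connForm e Y k l) x (X x) - dirDeriv (connForm e X k l) x (Y x)
        + ∑ m, (connForm e Y k m x * connForm e X m l x
          - connForm e X k m x * connForm e Y m l x)
        - connForm e (VectorField.mlieBracket (𝓡 4) X Y) k l x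
      = ∑ i, ∑ j, metric x (X x) (e i x) * metric x (Y x) (e j x) * frameRiem e i j k l x := by
  rw [hF.dirDeriv_connForm hx hX, hF.dirDeriv_connForm hx hY]
  have h1 : ∀ j, dirDeriv (christoffel e j k l) x (X x)
      = ∑ i, metric x (X x) (e i x) * dirDeriv (christoffel e j k l) x (e i x) := fun j =>
    hF.dirDeriv_eq_sum hx _ _
  have h2 : ∀ j, dirDeriv (christoffel e j k l) x (Y x)
      = ∑ i, metric x (Y x) (e i x) * dirDeriv (christoffel e j k l) x (e i x) := fun j =>
    hF.dirDeriv_eq_sum hx _ _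
  simp only [h1, h2]
  unfold connForm frameRiem
  simp only [hF.metric_mlieBracket hx hX hY]
  generalize hX' : (fun i => metric x (X x) (e i x)) = a
  generalize hY' : (fun i => metric x (Y x) (e i x)) = b
  simp only [funext_iff] at hX' hY'
  simp only [hX', hY', Fin.sum_univ_four]
  ring

/-- The components of the curvature tensor in the frame. -/
lemma metric_curvField (hF : IsOrthoFrame U e) {V : Set M} (hV : IsOpen V) (hVU : V ⊆ U)
    {X Y Z : ∀ x : M, Tan 4 x} (hX : SmoothFieldOn X V) (hY : SmoothFieldOn Y V)
    (hZ : SmoothFieldOn Z V) {x : M} (hx : x ∈ V) (l : Fin 4) :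
    metric x (curvField X Y Z x) (e l x) = ∑ k, ∑ i, ∑ j, metric x (X x) (e i x) *
      metric x (Y x) (e j x) * metric x (Z x) (e k x) * frameRiem e i j k l x := by
  rw [hF.metric_curvField_connForm hV hVU hX hY hZ hx]
  refine Finset.sum_congr rfl fun k _ => ?_
  rw [hF.connForm_curvature (hVU hx) (hX.diffField hV hx) (hY.diffField hV hx), Finset.mul_sum]
  refine Finset.sum_congr rfl fun i _ => ?_
  rw [Finset.mul_sum]
  exact Finset.sum_congr rfl fun j _ => by ring

lemma riem_eq_sum (hF : IsOrthoFrame U e) {x : M} (hx : x ∈ U) (u v w z : Tan 4 x) :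
    riem x u v w z = ∑ l, ∑ k, ∑ i, ∑ j, metric x u (e i x) * metric x v (e j x) *
      metric x w (e k x) * metric x z (e l x) * frameRiem e i j k l x := by
  -- The extensions are smooth only near `x`, so the formula is applied on a smaller open set.
  obtain ⟨s₁, ho₁, hx₁, h₁⟩ := exists_smoothFieldOn_extField u
  obtain ⟨s₂, ho₂, hx₂, h₂⟩ := exists_smoothFieldOn_extField v
  obtain ⟨s₃, ho₃, hx₃, h₃⟩ := exists_smoothFieldOn_extField w
  have key := fun l => hF.metric_curvField (V := U ∩ s₁ ∩ s₂ ∩ s₃)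
    (((hF.isOpen.inter ho₁).inter ho₂).inter ho₃) (fun y hy => hy.1.1.1)
    (ContMDiffOn.mono h₁ fun y hy => hy.1.1.2) (ContMDiffOn.mono h₂ fun y hy => hy.1.2)
    (ContMDiffOn.mono h₃ fun y hy => hy.2) ⟨⟨⟨hx, hx₁⟩, hx₂⟩, hx₃⟩ l
  unfold riem
  rw [hF.metric_eq_sum hx]
  refine Finset.sum_congr rfl fun l _ => ?_
  rw [key]
  simp only [extField_self, Finset.sum_mul]
  exact Finset.sum_congr rfl fun k _ => Finset.sum_congr rfl fun i _ =>
    Finset.sum_congr rfl fun j _ => by ring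

end IsOrthoFrame

end Curvature

/-! ### Coefficients of the curvature, Ricci and Weyl tensors in the frame. -/

section TensorCoefficients

/-- The value of a covariant 4-tensor with coefficients `t` on vectors with given coefficients. -/
def contract4 (u v w z : Fin 4 → ℝ) (t : Fin 4 → Fin 4 → Fin 4 → Fin 4 → ℝ) : ℝ :=
  ∑ i, u i * ∑ j, v j * ∑ k, w k * ∑ l, z l * t i j k l

lemma contract4_delta (t : Fin 4 → Fin 4 → Fin 4 → Fin 4 → ℝ) (i j k l : Fin 4) :
    contract4 (fun p => if i = p then 1 else 0) (fun p => if j = p then 1 else 0)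
      (fun p => if k = p then 1 else 0) (fun p => if l = p then 1 else 0) t = t i j k l := by
  simp [contract4]

lemma contract4_add (u v w z : Fin 4 → ℝ) (s t : Fin 4 → Fin 4 → Fin 4 → Fin 4 → ℝ) :
    contract4 u v w z (fun i j k l => s i j k l + t i j k l)
      = contract4 u v w z s + contract4 u v w z t := by
  simp only [contract4, mul_add, Finset.sum_add_distrib]

lemma contract4_smul (u v w z : Fin 4 → ℝ) (c : ℝ) (t : Fin 4 → Fin 4 → Fin 4 → Fin 4 → ℝ) :
    contract4 u v w z (fun i j k l => c * t i j k l) = c * contract4 u v w z t := by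
  simp only [contract4, Finset.mul_sum]
  exact Finset.sum_congr rfl fun i _ => Finset.sum_congr rfl fun j _ =>
    Finset.sum_congr rfl fun k _ => Finset.sum_congr rfl fun l _ => by ring

/-- The Kronecker symbol. -/
def kron (i j : Fin 4) : ℝ := if i = j then 1 else 0

lemma contract4_kron_outer (u v w z : Fin 4 → ℝ) (b : Fin 4 → Fin 4 → ℝ) :
    contract4 u v w z (fun i j k l => b j k * kron i l)
      = (∑ j, v j * ∑ k, w k * b j k) * ∑ i, u i * z i := by
  simp [contract4, kron, Fin.sum_univ_four]
  ring

lemma contract4_kron_inner (u v w z : Fin 4 → ℝ) (b : Fin 4 → Fin 4 → ℝ) :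
    contract4 u v w z (fun i j k l => b i l * kron j k)
      = (∑ j, u j * ∑ k, z k * b j k) * ∑ i, v i * w i := by
  simp [contract4, kron, Fin.sum_univ_four]
  ring

lemma contract4_kron_even (u v w z : Fin 4 → ℝ) (b : Fin 4 → Fin 4 → ℝ) :
    contract4 u v w z (fun i j k l => b i k * kron j l)
      = (∑ j, u j * ∑ k, w k * b j k) * ∑ i, v i * z i := by
  simp [contract4, kron, Fin.sum_univ_four]
  ring

lemma contract4_kron_odd (u v w z : Fin 4 → ℝ) (b : Fin 4 → Fin 4 → ℝ) :
    contract4 u v w z (fun i j k l => b j l * kron i k)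
      = (∑ j, v j * ∑ k, z k * b j k) * ∑ i, u i * w i := by
  simp [contract4, kron, Fin.sum_univ_four]
  ring

variable {M : Type*} [TopologicalSpace M] [ChartedSpace (EuclideanSpace ℝ (Fin 4)) M]
  [IsManifold (𝓡 4) ∞ M] [RiemannianBundle (fun x : M => TangentSpace (𝓡 4) x)]
  {U : Set M} {e : Fin 4 → ∀ x : M, Tan 4 x}

/-- The coefficients of the vector `v` in the frame `e`. -/
def coeff (e : Fin 4 → ∀ x : M, Tan 4 x) {x : M} (v : Tan 4 x) (i : Fin 4) : ℝ :=
  metric x v (e i x)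

lemma coeff_add {x : M} (v w : Tan 4 x) (i : Fin 4) :
    coeff e (v + w) i = coeff e v i + coeff e w i :=
  metric_add_left _ _ _ _

lemma coeff_smul {x : M} (c : ℝ) (v : Tan 4 x) (i : Fin 4) :
    coeff e (c • v) i = c * coeff e v i :=
  metric_smul_left _ _ _ _

/-- The coefficients of the covariant derivative of the tensor field with coefficients `t`. -/
def frameCov (e : Fin 4 → ∀ x : M, Tan 4 x) (t : Fin 4 → Fin 4 → Fin 4 → Fin 4 → M → ℝ)
    (m i j k l : Fin 4) (x : M) : ℝ :=
  dirDeriv (t i j k l) x (e m x)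
    - ∑ p, (christoffel e m i p x * t p j k l x + christoffel e m j p x * t i p k l x
        + christoffel e m k p x * t i j p l x + christoffel e m l p x * t i j k p x)

/-- The coefficients of the Ricci tensor in the frame `e`. -/
def frameRic (e : Fin 4 → ∀ x : M, Tan 4 x) (j k : Fin 4) (x : M) : ℝ :=
  ∑ i, frameRiem e i j k i x

/-- The scalar curvature in the frame `e`. -/
def frameScal (e : Fin 4 → ∀ x : M, Tan 4 x) (x : M) : ℝ :=
  ∑ i, frameRic e i i x

/-- The coefficients of the Weyl tensor in the frame `e`. -/
def frameWeyl (e : Fin 4 → ∀ x : M, Tan 4 x) (i j k l : Fin 4) (x : M) : ℝ :=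
  frameRiem e i j k l x
    - 1 / 2 * (frameRic e j k x * kron i l + frameRic e i l x * kron j k
        - frameRic e i k x * kron j l - frameRic e j l x * kron i k)
    + frameScal e x / 6 * (kron j k * kron i l - kron i k * kron j l)

namespace IsOrthoFrame

lemma coeff_frame (hF : IsOrthoFrame U e) {x : M} (hx : x ∈ U) (i : Fin 4) :
    coeff e (e i x) = fun p => if i = p then 1 else 0 :=
  funext fun p => hF.orthonormal x hx i p

lemma metric_eq_coeff (hF : IsOrthoFrame U e) {x : M} (hx : x ∈ U) (v w : Tan 4 x) :
    metric x v w = ∑ i, coeff e v i * coeff e w i :=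
  hF.metric_eq_sum hx v w

variable [IsContMDiffRiemannianBundle (𝓡 4) ∞ (EuclideanSpace ℝ (Fin 4))
      (fun x : M => TangentSpace (𝓡 4) x)]

lemma riem_eq_contract (hF : IsOrthoFrame U e) {x : M} (hx : x ∈ U) (u v w z : Tan 4 x) :
    riem x u v w z = contract4 (coeff e u) (coeff e v) (coeff e w) (coeff e z)
      (fun i j k l => frameRiem e i j k l x) := by
  rw [hF.riem_eq_sum hx]
  unfold contract4 coeff
  simp only [Fin.sum_univ_four]
  ring

/-- The trace over the unspecified basis `onb` becomes a trace over the frame once its argument is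
packaged as a bilinear form; `scal_eq` works in the same way. -/
lemma ricci_eq_sum (hF : IsOrthoFrame U e) {x : M} (hx : x ∈ U) (v w : Tan 4 x) :
    ricci x v w = ∑ j, coeff e v j * ∑ k, coeff e w k * frameRic e j k x := by
  let T : Tan 4 x →ₗ[ℝ] Tan 4 x →ₗ[ℝ] ℝ := LinearMap.mk₂ ℝ (fun u z => riem x u v w z)
    (fun a b c => by
      simp only [hF.riem_eq_contract hx, contract4, coeff_add, add_mul, Finset.sum_add_distrib])
    (fun c a b => by
      simp only [hF.riem_eq_contract hx, contract4, coeff_smul, mul_assoc, Finset.mul_sum,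
        smul_eq_mul])
    (fun a b c => by
      simp only [hF.riem_eq_contract hx, contract4, coeff_add, add_mul, Finset.sum_add_distrib,
        mul_add])
    (fun c a b => by
      simp only [hF.riem_eq_contract hx, contract4, coeff_smul, Finset.mul_sum, smul_eq_mul]
      refine Finset.sum_congr rfl fun i _ => Finset.sum_congr rfl fun j _ =>
        Finset.sum_congr rfl fun k _ => Finset.sum_congr rfl fun l _ => by ring)
  have h := hF.sum_onb_eq hx T
  have h2 : ricci x v w = ∑ a, T (onb x a) (onb x a) := rfl
  have h3 : ∀ i, T (e i x) (e i x)
      = ∑ j, coeff e v j * ∑ k, coeff e w k * frameRiem e i j k i x := by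
    intro i
    change riem x _ _ _ _ = _
    rw [hF.riem_eq_contract hx, hF.coeff_frame hx]
    simp [contract4]
  rw [h2, h]
  simp only [h3, frameRic, Finset.mul_sum]
  rw [Finset.sum_comm]
  refine Finset.sum_congr rfl fun j _ => ?_
  rw [Finset.sum_comm]

lemma ricci_frame (hF : IsOrthoFrame U e) {x : M} (hx : x ∈ U) (j k : Fin 4) :
    ricci x (e j x) (e k x) = frameRic e j k x := by
  rw [hF.ricci_eq_sum hx, hF.coeff_frame hx, hF.coeff_frame hx]
  simp

lemma scal_eq (hF : IsOrthoFrame U e) {x : M} (hx : x ∈ U) : scal 4 x = frameScal e x := by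
  let T : Tan 4 x →ₗ[ℝ] Tan 4 x →ₗ[ℝ] ℝ := LinearMap.mk₂ ℝ (fun v w => ricci x v w)
    (fun a b c => by
      simp only [hF.ricci_eq_sum hx, coeff_add, add_mul, Finset.sum_add_distrib])
    (fun c a b => by
      simp only [hF.ricci_eq_sum hx, coeff_smul, mul_assoc, Finset.mul_sum, smul_eq_mul])
    (fun a b c => by
      simp only [hF.ricci_eq_sum hx, coeff_add, add_mul, Finset.sum_add_distrib, mul_add])
    (fun c a b => by
      simp only [hF.ricci_eq_sum hx, coeff_smul, Finset.mul_sum, smul_eq_mul]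
      exact Finset.sum_congr rfl fun j _ => Finset.sum_congr rfl fun k _ => by ring)
  have h := hF.sum_onb_eq hx T
  have h2 : scal 4 x = ∑ a, T (onb x a) (onb x a) := rfl
  rw [h2, h]
  exact Finset.sum_congr rfl fun i _ => hF.ricci_frame hx i i

lemma weyl_eq_contract (hF : IsOrthoFrame U e) {x : M} (hx : x ∈ U) (u v w z : Tan 4 x) :
    weyl x u v w z = contract4 (coeff e u) (coeff e v) (coeff e w) (coeff e z)
      (fun i j k l => frameWeyl e i j k l x) := by
  have hk : ∀ a b : Tan 4 x, metric x a b = ∑ j, coeff e a j * ∑ k, coeff e b k * kron j k := by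
    intro a b
    rw [hF.metric_eq_coeff hx]
    simp [kron]
  have e1 : (fun i j k l => frameWeyl e i j k l x) = fun i j k l =>
      frameRiem e i j k l x
        + ((-1 / 2) * (frameRic e j k x * kron i l)
        + ((-1 / 2) * (frameRic e i l x * kron j k)
        + ((1 / 2) * (frameRic e i k x * kron j l)
        + ((1 / 2) * (frameRic e j l x * kron i k)
        + ((frameScal e x / 6) * (kron j k * kron i l)
        + (-frameScal e x / 6) * (kron i k * kron j l)))))) := by
    funext i j k l
    unfold frameWeyl
    ring
  rw [e1]
  simp only [contract4_add, contract4_smul]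
  rw [contract4_kron_outer (b := fun j k => frameRic e j k x),
    contract4_kron_inner (b := fun j k => frameRic e j k x),
    contract4_kron_even (b := fun j k => frameRic e j k x),
    contract4_kron_odd (b := fun j k => frameRic e j k x),
    contract4_kron_outer (b := kron), contract4_kron_even (b := kron)]
  simp only [← hF.ricci_eq_sum hx, ← hF.metric_eq_coeff hx, ← hk, ← hF.riem_eq_contract hx,
    ← hF.scal_eq hx]
  unfold weyl
  push_cast
  ring

lemma smoothOn_frameRiem (hF : IsOrthoFrame U e) (i j k l : Fin 4) :
    SmoothOn 4 (frameRiem e i j k l) U := by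
  unfold frameRiem
  have h := hF.smoothOn_christoffel
  refine ContMDiffOn.sub (ContMDiffOn.add (ContMDiffOn.sub
    (smoothOn_dirDeriv hF.isOpen (h _ _ _) (hF.smooth i))
    (smoothOn_dirDeriv hF.isOpen (h _ _ _) (hF.smooth j))) ?_) ?_
  · exact contMDiffOn_finsetSum fun m _ =>
      ((h _ _ _).mul (h _ _ _)).sub ((h _ _ _).mul (h _ _ _))
  · exact contMDiffOn_finsetSum fun m _ => ((h _ _ _).sub (h _ _ _)).mul (h _ _ _)

lemma smoothOn_frameRic (hF : IsOrthoFrame U e) (j k : Fin 4) :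
    SmoothOn 4 (frameRic e j k) U :=
  contMDiffOn_finsetSum fun i _ => hF.smoothOn_frameRiem i j k i

lemma smoothOn_frameScal (hF : IsOrthoFrame U e) : SmoothOn 4 (frameScal e) U :=
  contMDiffOn_finsetSum fun i _ => hF.smoothOn_frameRic i i

lemma smoothOn_frameWeyl (hF : IsOrthoFrame U e) (i j k l : Fin 4) :
    SmoothOn 4 (frameWeyl e i j k l) U := by
  unfold frameWeyl
  have h := hF.smoothOn_frameRic
  refine ContMDiffOn.add (ContMDiffOn.sub (hF.smoothOn_frameRiem i j k l)
    (contMDiffOn_const.mul (((ContMDiffOn.add ?_ ?_).sub ?_).sub ?_))) ?_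
  · exact (h _ _).mul contMDiffOn_const
  · exact (h _ _).mul contMDiffOn_const
  · exact (h _ _).mul contMDiffOn_const
  · exact (h _ _).mul contMDiffOn_const
  · simp only [div_eq_mul_inv]
    exact ((hF.smoothOn_frameScal).mul contMDiffOn_const).mul contMDiffOn_const

end IsOrthoFrame

end TensorCoefficients

/-! ### Covariant derivatives of tensors, divergence of the Weyl tensor, Jacobi identity and Hessian
in the frame. -/

section CovariantDerivative

lemma contract4_sum (u v w z a : Fin 4 → ℝ) (t : Fin 4 → Fin 4 → Fin 4 → Fin 4 → Fin 4 → ℝ) :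
    contract4 u v w z (fun i j k l => ∑ m, a m * t m i j k l)
      = ∑ m, a m * contract4 u v w z (t m) := by
  simp only [Fin.sum_univ_four (f := fun m => a m * t m _ _ _ _), contract4_add, contract4_smul]
  rw [Fin.sum_univ_four]

lemma sum_mul_sum_mul_comm (g v : Fin 4 → ℝ) (f : Fin 4 → Fin 4 → ℝ) :
    ∑ p, g p * ∑ j, v j * f p j = ∑ j, v j * ∑ p, g p * f p j := by
  simp only [Finset.mul_sum]
  rw [Finset.sum_comm]
  exact Finset.sum_congr rfl fun j _ => Finset.sum_congr rfl fun p _ => by ring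

/-- The connection terms added to the vector factor are exactly those subtracted from the covector
factor. -/
lemma sum_product_rule (u du S dS : Fin 4 → ℝ) (G : Fin 4 → Fin 4 → ℝ) :
    ∑ i, (u i * dS i + S i * du i)
      = ∑ i, u i * (dS i - ∑ p, G i p * S p) + ∑ i, (du i + ∑ k, u k * G k i) * S i := by
  simp only [Fin.sum_univ_four]
  ring

variable {M : Type*} [TopologicalSpace M] [ChartedSpace (EuclideanSpace ℝ (Fin 4)) M]
  [IsManifold (𝓡 4) ∞ M] [RiemannianBundle (fun x : M => TangentSpace (𝓡 4) x)]
  {U : Set M} {e : Fin 4 → ∀ x : M, Tan 4 x}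
  [IsContMDiffRiemannianBundle (𝓡 4) ∞ (EuclideanSpace ℝ (Fin 4))
      (fun x : M => TangentSpace (𝓡 4) x)]

namespace IsOrthoFrame

lemma coeff_covAt (hF : IsOrthoFrame U e) {x : M} (hx : x ∈ U) {Y : ∀ x : M, Tan 4 x}
    (hY : DiffField Y x) (v : Tan 4 x) (l : Fin 4) :
    coeff e (covAt x v Y) l = dirDeriv (fun y => coeff e (Y y) l) x v
      + ∑ k, coeff e (Y x) k * ∑ m, coeff e v m * christoffel e m k l x :=
  hF.metric_covAt_frame hx hY v l

lemma diffFun_sum_coeff_mul (hF : IsOrthoFrame U e) {x : M} (hx : x ∈ U) {Y : ∀ x : M, Tan 4 x}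
    (hY : DiffField Y x) {S : Fin 4 → M → ℝ} (hS : ∀ i, DiffFun 4 (S i) x) :
    DiffFun 4 (fun y => ∑ i, coeff e (Y y) i * S i y) x :=
  DiffFun.sum _ fun i => (hF.diffFun_coeff hx hY i).mul (hS i)

/-- The product rule for a contraction with a vector field. -/
lemma dirDeriv_sum_coeff_mul (hF : IsOrthoFrame U e) {x : M} (hx : x ∈ U) {Y : ∀ x : M, Tan 4 x}
    (hY : DiffField Y x) {S : Fin 4 → M → ℝ} (hS : ∀ i, DiffFun 4 (S i) x) (a : Tan 4 x) :
    dirDeriv (fun y => ∑ i, coeff e (Y y) i * S i y) x a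
      = ∑ i, coeff e (Y x) i * (dirDeriv (S i) x a
          - ∑ p, (∑ m, coeff e a m * christoffel e m i p x) * S p x)
        + ∑ i, coeff e (covAt x a Y) i * S i x := by
  simp only [hF.coeff_covAt hx hY]
  rw [← sum_product_rule, dirDeriv_sum (φ := fun i y => coeff e (Y y) i * S i y) _
    fun i => (hF.diffFun_coeff hx hY i).mul (hS i)]
  exact Finset.sum_congr rfl fun i _ => dirDeriv_mul (hF.diffFun_coeff hx hY i) (hS i) a

/-- The components of the covariant derivative of a 4-tensor in the frame. -/
lemma covTensor_eq_contract (hF : IsOrthoFrame U e)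
    {T : ∀ x : M, Tan 4 x → Tan 4 x → Tan 4 x → Tan 4 x → ℝ}
    {t : Fin 4 → Fin 4 → Fin 4 → Fin 4 → M → ℝ}
    (hT : ∀ y ∈ U, ∀ u v w z, T y u v w z = contract4 (coeff e u) (coeff e v) (coeff e w)
      (coeff e z) (fun i j k l => t i j k l y))
    (ht : ∀ i j k l, SmoothOn 4 (t i j k l) U) {x : M} (hx : x ∈ U) (a u v w z : Tan 4 x) :
    covTensor T x a u v w z = ∑ m, coeff e a m * contract4 (coeff e u) (coeff e v) (coeff e w)
      (coeff e z) (fun i j k l => frameCov e t m i j k l x) := by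
  have hu := diffField_extField u
  have hv := diffField_extField v
  have hw := diffField_extField w
  have hz := diffField_extField z
  have d4 : ∀ i j k l, DiffFun 4 (t i j k l) x := fun i j k l => (ht i j k l).diffFun hF.isOpen hx
  have d3 := fun i j k => hF.diffFun_sum_coeff_mul hx hz (d4 i j k)
  have d2 := fun i j => hF.diffFun_sum_coeff_mul hx hw (d3 i j)
  have d1 := fun i => hF.diffFun_sum_coeff_mul hx hv (d2 i)
  unfold covTensor
  rw [dirDeriv_congr (ψ := fun y => contract4 (coeff e (extField u y)) (coeff e (extField v y))
      (coeff e (extField w y)) (coeff e (extField z y)) (fun i j k l => t i j k l y))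
    (by filter_upwards [hF.isOpen.mem_nhds hx] with y hy using hT y hy _ _ _ _)]
  simp only [hT x hx]
  -- The four slots are differentiated one at a time, from the innermost contraction outwards.
  have s4 := fun i j k => hF.dirDeriv_sum_coeff_mul hx hz (d4 i j k) a
  have s3 := fun i j => hF.dirDeriv_sum_coeff_mul hx hw (d3 i j) a
  have s2 := fun i => hF.dirDeriv_sum_coeff_mul hx hv (d2 i) a
  have s1 := hF.dirDeriv_sum_coeff_mul hx hu d1 a
  simp only [s4] at s3
  simp only [s3] at s2
  simp only [s2] at s1
  simp only [extField_self] at s1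
  unfold contract4
  rw [s1]
  have hE : ∀ i j k l, dirDeriv (t i j k l) x a
      = ∑ m, coeff e a m * dirDeriv (t i j k l) x (e m x) := fun i j k l =>
    hF.dirDeriv_eq_sum hx _ _
  have rhs : ∑ m, coeff e a m * contract4 (coeff e u) (coeff e v) (coeff e w)
      (coeff e z) (fun i j k l => frameCov e t m i j k l x)
      = contract4 (coeff e u) (coeff e v) (coeff e w) (coeff e z) (fun i j k l =>
        dirDeriv (t i j k l) x a
          - ∑ p, (∑ m, coeff e a m * christoffel e m l p x) * t i j k p x
          - ∑ p, (∑ m, coeff e a m * christoffel e m k p x) * t i j p l x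
          - ∑ p, (∑ m, coeff e a m * christoffel e m j p x) * t i p k l x
          - ∑ p, (∑ m, coeff e a m * christoffel e m i p x) * t p j k l x) := by
    rw [← contract4_sum]
    congr 1
    funext i j k l
    rw [hE]
    unfold frameCov
    simp only [Fin.sum_univ_four]
    ring
  unfold contract4 at rhs
  rw [rhs]
  obtain ⟨G, hG⟩ : ∃ G : Fin 4 → Fin 4 → ℝ,
      ∀ i p, ∑ m, coeff e a m * christoffel e m i p x = G i p := ⟨_, fun _ _ => rfl⟩
  -- The connection terms must be moved inside the nested sums before the two sides agree summand by
  -- summand.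
  have hsw : ∀ (q : Fin 4) (v : Fin 4 → ℝ) (f : Fin 4 → Fin 4 → ℝ),
      ∑ p, G q p * ∑ j, v j * f p j = ∑ j, v j * ∑ p, G q p * f p j := fun q v f =>
    sum_mul_sum_mul_comm (G q) v f
  simp only [hG, hsw, mul_add, mul_sub, Finset.sum_add_distrib, Finset.sum_sub_distrib]
  ring

/-- The divergence of the Weyl tensor vanishes in the frame. -/
lemma sum_frameCov_frameWeyl (hF : IsOrthoFrame U e) (hW : HarmonicWeyl 4 M) {x : M} (hx : x ∈ U)
    (j k l : Fin 4) : ∑ i, frameCov e (frameWeyl e) i i j k l x = 0 := by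
  have hc := fun a u v w z => hF.covTensor_eq_contract (T := weyl) (t := frameWeyl e)
    (fun y hy => hF.weyl_eq_contract hy) hF.smoothOn_frameWeyl hx a u v w z
  let T : Tan 4 x →ₗ[ℝ] Tan 4 x →ₗ[ℝ] ℝ := LinearMap.mk₂ ℝ
    (fun a u => covTensor weyl x a u (e j x) (e k x) (e l x))
    (fun a b c => by simp only [hc, coeff_add, add_mul, Finset.sum_add_distrib])
    (fun c a b => by simp only [hc, coeff_smul, mul_assoc, Finset.mul_sum, smul_eq_mul])
    (fun a b c => by
      simp only [hc, contract4, coeff_add, add_mul, Finset.sum_add_distrib, mul_add])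
    (fun c a b => by
      simp only [hc, contract4, coeff_smul, Finset.mul_sum, smul_eq_mul]
      exact Finset.sum_congr rfl fun m _ => Finset.sum_congr rfl fun i _ =>
        Finset.sum_congr rfl fun j _ => Finset.sum_congr rfl fun k _ =>
        Finset.sum_congr rfl fun l _ => by ring)
  have h := hF.sum_onb_eq hx T
  have h2 : ∑ a, T (onb x a) (onb x a) = 0 := neg_eq_zero.1 (hW x (e j x) (e k x) (e l x))
  rw [h2] at h
  rw [h]
  refine Finset.sum_congr rfl fun i _ => ?_
  change _ = covTensor weyl x _ _ _ _ _
  rw [hc]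
  simp only [hF.coeff_frame hx, contract4_delta]
  simp

/-- The components of the Lie bracket of two frame fields. -/
lemma mlieBracket_frame (hF : IsOrthoFrame U e) {x : M} (hx : x ∈ U) (i j : Fin 4) :
    VectorField.mlieBracket (𝓡 4) (e i) (e j) x
      = ∑ k, (christoffel e i j k x - christoffel e j i k x) • e k x := by
  rw [← covAt_sub_covAt (hF.diffField hx i) (hF.diffField hx j),
    ← hF.sum_metric_smul hx (covAt x (e i x) (e j) - covAt x (e j x) (e i))]
  simp only [metric_sub_left]
  rfl

lemma dirDeriv_comm (hF : IsOrthoFrame U e) {φ : M → ℝ} (hφ : SmoothOn 4 φ U) {x : M} (hx : x ∈ U)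
    (i j : Fin 4) :
    dirDeriv (fun y => dirDeriv φ y (e j y)) x (e i x)
      - dirDeriv (fun y => dirDeriv φ y (e i y)) x (e j x)
      = ∑ k, (christoffel e i j k x - christoffel e j i k x) * dirDeriv φ x (e k x) := by
  rw [← dirDeriv_mlieBracket hF.isOpen hφ (hF.smooth i) (hF.smooth j) (hF.smooth 0) hx
    (hF.ne_zero hx 0), hF.mlieBracket_frame hx, dirDeriv_sum_right]
  simp only [dirDeriv_smul_right]

/-- The structure functions `c` of the frame, `[eᵢ,eⱼ] = ∑ₖ cᵢⱼₖ eₖ`. -/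
def structFun (e : Fin 4 → ∀ x : M, Tan 4 x) (i j k : Fin 4) (x : M) : ℝ :=
  christoffel e i j k x - christoffel e j i k x

lemma mlieBracket_mlieBracket_frame (hF : IsOrthoFrame U e) {x : M} (hx : x ∈ U)
    (i j k l : Fin 4) :
    metric x (VectorField.mlieBracket (𝓡 4) (e i) (VectorField.mlieBracket (𝓡 4) (e j) (e k)) x)
      (e l x) = dirDeriv (structFun e j k l) x (e i x)
        + ∑ m, structFun e j k m x * structFun e i m l x := by
  have hY := (SmoothFieldOn.mlieBracket hF.isOpen (hF.smooth j) (hF.smooth k)).diffField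
    hF.isOpen hx
  have hc : ∀ y ∈ U, ∀ m, metric y (VectorField.mlieBracket (𝓡 4) (e j) (e k) y) (e m y)
      = structFun e j k m y := by
    intro y hy m
    rw [hF.mlieBracket_frame hy, metric_sum_left]
    simp [metric_smul_left, hF.orthonormal y hy, structFun]
  rw [hF.metric_mlieBracket hx (hF.diffField hx i) hY]
  rw [dirDeriv_congr (φ := fun y => metric y (VectorField.mlieBracket (𝓡 4) (e j) (e k) y) (e l y))
      (ψ := structFun e j k l)
      (by filter_upwards [hF.isOpen.mem_nhds hx] with y hy using hc y hy l),
    dirDeriv_congr (φ := fun y => metric y (e i y) (e l y)) (ψ := fun _ => if i = l then 1 else 0)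
      (by filter_upwards [hF.isOpen.mem_nhds hx] with y hy using hF.orthonormal y hy i l),
    dirDeriv_const]
  simp [hc x hx, hF.orthonormal x hx, structFun]

/-- The Jacobi identity for the frame. -/
lemma structFun_jacobi (hF : IsOrthoFrame U e) {x : M} (hx : x ∈ U) (i j k l : Fin 4) :
    dirDeriv (structFun e j k l) x (e i x) + ∑ m, structFun e j k m x * structFun e i m l x
      + (dirDeriv (structFun e k i l) x (e j x) + ∑ m, structFun e k i m x * structFun e j m l x)
      + (dirDeriv (structFun e i j l) x (e k x) + ∑ m, structFun e i j m x * structFun e k m l x)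
      = 0 := by
  have aux : ∀ i, ContMDiffAt (𝓡 4) (𝓡 4).tangent (minSmoothness ℝ 2)
        (fun x => (⟨x, e i x⟩ : TangentBundle (𝓡 4) M)) x := by
    intro i
    refine (ContMDiffOn.contMDiffAt (hF.smooth i) (hF.isOpen.mem_nhds hx)).of_le ?_
    rw [minSmoothness_of_isRCLikeNormedField]
    exact ENat.LEInfty.out
  have h := VectorField.leibniz_identity_mlieBracket_apply (aux i) (aux j) (aux k)
  -- Two swaps of bracket arguments turn the Leibniz form of the identity into the cyclic one.
  rw [VectorField.mlieBracket_swap_apply (V := VectorField.mlieBracket (𝓡 4) (e i) (e j)),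
    VectorField.mlieBracket_swap (V := e i) (W := e k)] at h
  have hneg : VectorField.mlieBracket (𝓡 4) (e j) (-VectorField.mlieBracket (𝓡 4) (e k) (e i)) x
      = -VectorField.mlieBracket (𝓡 4) (e j) (VectorField.mlieBracket (𝓡 4) (e k) (e i)) x := by
    have hd := (SmoothFieldOn.mlieBracket hF.isOpen (hF.smooth k) (hF.smooth i)).diffField
      hF.isOpen hx
    have := VectorField.mlieBracket_const_smul_right (V := e j) (c := (-1 : ℝ)) hd
    simpa using this
  rw [hneg] at h
  have h' := congrArg (fun v => metric x v (e l x)) h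
  simp only [metric_add_left, metric_neg_left, hF.mlieBracket_mlieBracket_frame hx] at h'
  linarith

/-- The Hessian in the frame. -/
lemma hess_frame (hF : IsOrthoFrame U e) {f : M → ℝ} (hf : SmoothOn 4 f U) {x : M} (hx : x ∈ U)
    (i j : Fin 4) :
    hess f x (e i x) (e j x) = dirDeriv (fun y => dirDeriv f y (e j y)) x (e i x)
      + ∑ k, dirDeriv f x (e k x) * christoffel e i k j x := by
  have hg : ∀ y : M, ∀ v : Tan 4 y, metric y (grad f y) v = dirDeriv f y v := fun y v =>
    metric_extend_sum (dirDeriv_add_right f y) (dirDeriv_smul_right f y) v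
  have hs : SmoothFieldOn (grad (n := 4) f) U := by
    refine hF.smoothFieldOn_of_metric subset_rfl fun i => ?_
    simp only [hg]
    exact smoothOn_dirDeriv hF.isOpen hf (hF.smooth i)
  unfold hess
  rw [hF.metric_covAt_frame hx (hs.diffField hF.isOpen hx)]
  simp [hg, hF.orthonormal x hx]

end IsOrthoFrame

end CovariantDerivative

/-! ### Differential algebra of a frame: Bianchi identities and the Codazzi equation. -/

section FrameAlgebra

/-- The algebraic data of an orthonormal frame on a 4-manifold: the derivations along the frame
fields on the algebra of functions, and the Christoffel symbols of the Levi-Civita connection. -/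
structure FrameAlg (A : Type*) [CommRing A] [Algebra ℝ A] where
  E : Fin 4 → Derivation ℝ A A
  Γ : Fin 4 → Fin 4 → Fin 4 → A
  anti : ∀ i j k, Γ i j k = -Γ i k j
  comm : ∀ i j φ, E i (E j φ) - E j (E i φ) = ∑ k, (Γ i j k - Γ j i k) * E k φ
  jacobi : ∀ i j k l,
    E i (Γ j k l - Γ k j l) + ∑ m, (Γ j k m - Γ k j m) * (Γ i m l - Γ m i l)
    + (E j (Γ k i l - Γ i k l) + ∑ m, (Γ k i m - Γ i k m) * (Γ j m l - Γ m j l))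
    + (E k (Γ i j l - Γ j i l) + ∑ m, (Γ i j m - Γ j i m) * (Γ k m l - Γ m k l)) = 0

namespace FrameAlg

variable {A : Type*} [CommRing A] [Algebra ℝ A] (F : FrameAlg A)

/-- The Riemann curvature tensor. -/
def rm (i j k l : Fin 4) : A :=
  F.E i (F.Γ j k l) - F.E j (F.Γ i k l)
    + ∑ m, (F.Γ j k m * F.Γ i m l - F.Γ i k m * F.Γ j m l)
    - ∑ m, (F.Γ i j m - F.Γ j i m) * F.Γ m k l

/-- The Ricci tensor. -/
def ric (j k : Fin 4) : A := ∑ i, F.rm i j k i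

/-- The scalar curvature. -/
def sc : A := ∑ i, F.ric i i

/-- The Kronecker symbol. -/
def δ (A : Type*) [CommRing A] (i j : Fin 4) : A := if i = j then 1 else 0

/-- The covariant derivative of a covariant 2-tensor. -/
def cov2 (b : Fin 4 → Fin 4 → A) (m j k : Fin 4) : A :=
  F.E m (b j k) - ∑ p, (F.Γ m j p * b p k + F.Γ m k p * b j p)

/-- The covariant derivative of a covariant 4-tensor. -/
def cov4 (t : Fin 4 → Fin 4 → Fin 4 → Fin 4 → A) (m i j k l : Fin 4) : A :=
  F.E m (t i j k l)
    - ∑ p, (F.Γ m i p * t p j k l + F.Γ m j p * t i p k l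
        + F.Γ m k p * t i j p l + F.Γ m l p * t i j k p)

/-- Six times the Weyl tensor. -/
def weyl6 (i j k l : Fin 4) : A :=
  6 * F.rm i j k l
    - 3 * (F.ric j k * δ A i l + F.ric i l * δ A j k - F.ric i k * δ A j l - F.ric j l * δ A i k)
    + F.sc * (δ A j k * δ A i l - δ A i k * δ A j l)

lemma rm_swap (i j k l : Fin 4) : F.rm i j k l = -F.rm j i k l := by
  unfold rm
  simp only [Fin.sum_univ_four]
  ring

lemma rm_swap' (i j k l : Fin 4) : F.rm i j k l = -F.rm i j l k := by
  unfold rm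
  rw [F.anti j k l, F.anti i k l]
  have h1 : ∀ m, F.Γ j k m * F.Γ i m l - F.Γ i k m * F.Γ j m l
      = -(F.Γ j l m * F.Γ i m k - F.Γ i l m * F.Γ j m k) := fun m => by
    rw [F.anti j k m, F.anti i m l, F.anti i k m, F.anti j m l]; ring
  have h2 : ∀ m, (F.Γ i j m - F.Γ j i m) * F.Γ m k l
      = -((F.Γ i j m - F.Γ j i m) * F.Γ m l k) := fun m => by
    rw [F.anti m k l]; ring
  simp only [h1, h2, Finset.sum_neg_distrib, map_neg]
  ring

/-- The first Bianchi identity. -/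
lemma rm_cyclic (i j k l : Fin 4) : F.rm i j k l + F.rm j k i l + F.rm k i j l = 0 := by
  rw [← F.jacobi i j k l]
  unfold rm
  simp only [Fin.sum_univ_four, map_sub]
  ring

/-- Nonzero numerals are units in a real algebra; this replaces division in what follows. -/
lemma ofNat_mul_cancel (m : ℕ) [m.AtLeastTwo] {x y : A}
    (h : (OfNat.ofNat m : A) * x = OfNat.ofNat m * y) : x = y := by
  have hu : IsUnit (algebraMap ℝ A (OfNat.ofNat m)) :=
    IsUnit.map _ (isUnit_iff_ne_zero.2 (OfNat.ofNat_ne_zero m))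
  rw [map_ofNat] at hu
  exact hu.mul_left_cancel h

/-- The usual octahedron argument: a signed combination of four first Bianchi identities, brought to
common terms by the antisymmetries. -/
lemma rm_pair (i j k l : Fin 4) : F.rm i j k l = F.rm k l i j := by
  refine ofNat_mul_cancel 2 ?_
  have h1 := F.rm_cyclic i j k l
  have h2 := F.rm_cyclic j k l i
  have h3 := F.rm_cyclic k l i j
  have h4 := F.rm_cyclic l i j k
  rw [F.rm_swap' j k l i, F.rm_swap' k l j i, F.rm_swap l j k i] at h2
  rw [F.rm_swap l i k j, F.rm_swap' i l k j, F.rm_swap i k l j, F.rm_swap' k i l j] at h3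
  rw [F.rm_swap l i j k, F.rm_swap' i j l k, F.rm_swap' j l i k] at h4
  linear_combination h1 + h2 - h3 - h4

lemma ric_comm (j k : Fin 4) : F.ric j k = F.ric k j :=
  Finset.sum_congr rfl fun i _ => by
    rw [F.rm_pair i j k i, F.rm_swap k i i j, F.rm_swap' i k i j, neg_neg]

set_option maxHeartbeats 4000000 in
/-- The second Bianchi identity. -/
lemma cov4_rm_cyclic (m i j k l : Fin 4) :
    F.cov4 F.rm m i j k l + F.cov4 F.rm i j m k l + F.cov4 F.rm j m i k l = 0 := by
  -- The commutators remove the second derivatives of the Christoffel symbols, and the Jacobi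
  -- identity contracted with `F.Γ p k l` removes the derivatives of the structure functions; the
  -- rest is polynomial.
  have c1 := F.comm m i (F.Γ j k l)
  have c2 := F.comm i j (F.Γ m k l)
  have c3 := F.comm j m (F.Γ i k l)
  have J : ∑ p, (F.E m (F.Γ i j p - F.Γ j i p)
        + ∑ q, (F.Γ i j q - F.Γ j i q) * (F.Γ m q p - F.Γ q m p)
      + (F.E i (F.Γ j m p - F.Γ m j p)
        + ∑ q, (F.Γ j m q - F.Γ m j q) * (F.Γ i q p - F.Γ q i p))
      + (F.E j (F.Γ m i p - F.Γ i m p)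
        + ∑ q, (F.Γ m i q - F.Γ i m q) * (F.Γ j q p - F.Γ q j p))) * F.Γ p k l = 0 :=
    Finset.sum_eq_zero fun p _ => by rw [F.jacobi m i j p, zero_mul]
  unfold cov4
  simp only [F.anti _ l _]
  unfold rm
  simp only [Fin.sum_univ_four, map_add, map_sub, Derivation.leibniz, smul_eq_mul] at c1 c2 c3 J ⊢
  linear_combination c1 + c2 + c3 - J

lemma cov4_rm_swap (m i j k l : Fin 4) : F.cov4 F.rm m i j k l = -F.cov4 F.rm m j i k l := by
  unfold cov4
  have h := F.rm_swap
  have e1 : ∀ p, F.Γ m i p * F.rm p j k l + F.Γ m j p * F.rm i p k l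
        + F.Γ m k p * F.rm i j p l + F.Γ m l p * F.rm i j k p
      = -(F.Γ m j p * F.rm p i k l + F.Γ m i p * F.rm j p k l
        + F.Γ m k p * F.rm j i p l + F.Γ m l p * F.rm j i k p) := fun p => by
    rw [h p j k l, h i p k l, h i j p l, h i j k p]; ring
  rw [h i j k l]
  simp only [e1, Finset.sum_neg_distrib, map_neg]
  ring

lemma cov4_rm_swap' (m i j k l : Fin 4) : F.cov4 F.rm m i j k l = -F.cov4 F.rm m i j l k := by
  unfold cov4
  have h := F.rm_swap'
  have e1 : ∀ p, F.Γ m i p * F.rm p j k l + F.Γ m j p * F.rm i p k l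
        + F.Γ m k p * F.rm i j p l + F.Γ m l p * F.rm i j k p
      = -(F.Γ m i p * F.rm p j l k + F.Γ m j p * F.rm i p l k
        + F.Γ m l p * F.rm i j p k + F.Γ m k p * F.rm i j l p) := fun p => by
    rw [h p j k l, h i p k l, h i j p l, h i j k p]; ring
  rw [h i j k l]
  simp only [e1, Finset.sum_neg_distrib, map_neg]
  ring

lemma cov4_rm_pair (m i j k l : Fin 4) : F.cov4 F.rm m i j k l = F.cov4 F.rm m k l i j := by
  unfold cov4
  have h := F.rm_pair
  rw [h i j k l]
  congr 1
  exact Finset.sum_congr rfl fun p _ => by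
    rw [h p j k l, h i p k l, h i j p l, h i j k p]; ring

/-- Covariant differentiation commutes with the contraction defining the Ricci tensor. -/
lemma sum_cov4_rm (m j k : Fin 4) : ∑ i, F.cov4 F.rm m i j k i = F.cov2 F.ric m j k := by
  have h0 : ∑ i, ∑ p, F.Γ m i p * F.rm i j k p = -∑ i, ∑ p, F.Γ m i p * F.rm p j k i := by
    rw [Finset.sum_comm, ← Finset.sum_neg_distrib]
    refine Finset.sum_congr rfl fun p _ => ?_
    rw [← Finset.sum_neg_distrib]
    exact Finset.sum_congr rfl fun i _ => by rw [F.anti m i p]; ring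
  have h1 : ∑ i, ∑ p, F.Γ m j p * F.rm i p k i = ∑ p, F.Γ m j p * F.ric p k := by
    rw [Finset.sum_comm]
    exact Finset.sum_congr rfl fun p _ => by rw [ric, Finset.mul_sum]
  have h2 : ∑ i, ∑ p, F.Γ m k p * F.rm i j p i = ∑ p, F.Γ m k p * F.ric j p := by
    rw [Finset.sum_comm]
    exact Finset.sum_congr rfl fun p _ => by rw [ric, Finset.mul_sum]
  unfold cov4 cov2
  simp only [Finset.sum_sub_distrib, Finset.sum_add_distrib]
  rw [h0, h1, h2]
  conv_rhs => rw [ric, map_sum]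
  ring

/-- The divergence of the curvature tensor. -/
lemma sum_cov4_rm_div (j k l : Fin 4) :
    ∑ i, F.cov4 F.rm i i j k l = F.cov2 F.ric l k j - F.cov2 F.ric k l j := by
  rw [← F.sum_cov4_rm l k j, ← F.sum_cov4_rm k l j, ← Finset.sum_sub_distrib]
  refine Finset.sum_congr rfl fun i _ => ?_
  -- Pair symmetry moves the divergence index to the second pair, so that the second Bianchi
  -- identity contracts to derivatives of Ricci.
  have h := F.cov4_rm_cyclic i k l i j
  rw [F.cov4_rm_pair i i j k l]
  rw [F.cov4_rm_swap k l i i j, F.cov4_rm_swap' k i l i j, F.cov4_rm_swap' l i k i j] at h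
  linear_combination h

lemma cov2_ric_comm (m j k : Fin 4) : F.cov2 F.ric m j k = F.cov2 F.ric m k j := by
  unfold cov2
  rw [F.ric_comm j k]
  congr 1
  exact Finset.sum_congr rfl fun p _ => by rw [F.ric_comm p k, F.ric_comm j p]; ring

/-- The connection terms pair a symmetric sum with the antisymmetric symbols `F.Γ l i p` and cancel.
-/
lemma sum_cov2_ric (l : Fin 4) : ∑ j, F.cov2 F.ric l j j = F.E l F.sc := by
  unfold cov2 sc
  rw [map_sum, Finset.sum_sub_distrib, sub_eq_self]
  simp only [Finset.sum_add_distrib]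
  rw [Finset.sum_comm, ← Finset.sum_add_distrib]
  refine Finset.sum_eq_zero fun p _ => ?_
  rw [← Finset.sum_add_distrib]
  exact Finset.sum_eq_zero fun i _ => by rw [F.anti l i p]; ring

/-- The contracted second Bianchi identity. -/
lemma two_mul_sum_cov2_ric (l : Fin 4) : 2 * ∑ i, F.cov2 F.ric i i l = F.E l F.sc := by
  -- The double trace of `∇Rm` is evaluated in both orders: directly as a divergence of Ricci, and
  -- through `sum_cov4_rm_div`.
  have h1 : ∑ j, ∑ i, F.cov4 F.rm i i j j l = ∑ i, F.cov2 F.ric i i l := by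
    rw [Finset.sum_comm]
    refine Finset.sum_congr rfl fun i _ => ?_
    rw [← F.sum_cov4_rm i i l]
    exact Finset.sum_congr rfl fun j _ => by
      rw [F.cov4_rm_swap i i j j l, F.cov4_rm_swap' i j i j l, neg_neg]
  have h2 : ∑ j, F.cov2 F.ric j l j = ∑ j, F.cov2 F.ric j j l :=
    Finset.sum_congr rfl fun j _ => F.cov2_ric_comm j l j
  simp only [F.sum_cov4_rm_div, Finset.sum_sub_distrib] at h1
  rw [F.sum_cov2_ric, h2] at h1
  linear_combination -h1

lemma E_δ (m i j : Fin 4) : F.E m (δ A i j) = 0 := by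
  unfold δ
  split_ifs <;> simp

lemma sum_mul_δ (g : Fin 4 → A) (j : Fin 4) : ∑ p, g p * δ A p j = g j := by
  simp [δ]

lemma sum_mul_δ' (g : Fin 4 → A) (j : Fin 4) : ∑ p, g p * δ A j p = g j := by
  simp [δ]

/-- The metric is parallel: the two connection terms falling on `δ` cancel by antisymmetry. The
other placements of `δ` follow by permuting the slots. -/
lemma cov4_mul_δ_outer (b : Fin 4 → Fin 4 → A) (m i j k l : Fin 4) :
    F.cov4 (fun i j k l => b j k * δ A i l) m i j k l = F.cov2 b m j k * δ A i l := by
  have h1 : ∑ p, F.Γ m i p * (b j k * δ A p l) = b j k * F.Γ m i l := by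
    rw [← sum_mul_δ (F.Γ m i) l, Finset.mul_sum]
    exact Finset.sum_congr rfl fun p _ => by ring
  have h2 : ∑ p, F.Γ m l p * (b j k * δ A i p) = b j k * F.Γ m l i := by
    rw [← sum_mul_δ' (F.Γ m l) i, Finset.mul_sum]
    exact Finset.sum_congr rfl fun p _ => by ring
  unfold cov4 cov2
  simp only [Finset.sum_add_distrib, h1, h2, Derivation.leibniz, E_δ, smul_eq_mul, sub_mul,
    add_mul, Finset.sum_mul]
  rw [F.anti m i l]
  simp only [mul_assoc]
  ring

lemma cov4_perm_inner (b : Fin 4 → Fin 4 → A) (m i j k l : Fin 4) :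
    F.cov4 (fun i j k l => b i l * δ A j k) m i j k l = F.cov2 b m i l * δ A j k := by
  rw [← F.cov4_mul_δ_outer b m j i l k]
  unfold cov4
  congr 1
  exact Finset.sum_congr rfl fun p _ => by ring

lemma cov4_perm_even (b : Fin 4 → Fin 4 → A) (m i j k l : Fin 4) :
    F.cov4 (fun i j k l => b i k * δ A j l) m i j k l = F.cov2 b m i k * δ A j l := by
  rw [← F.cov4_mul_δ_outer b m j i k l]
  unfold cov4
  congr 1
  exact Finset.sum_congr rfl fun p _ => by ring

lemma cov4_perm_odd (b : Fin 4 → Fin 4 → A) (m i j k l : Fin 4) :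
    F.cov4 (fun i j k l => b j l * δ A i k) m i j k l = F.cov2 b m j l * δ A i k := by
  rw [← F.cov4_mul_δ_outer b m i j l k]
  unfold cov4
  congr 1
  exact Finset.sum_congr rfl fun p _ => by ring

lemma cov4_add (s t : Fin 4 → Fin 4 → Fin 4 → Fin 4 → A) (m i j k l : Fin 4) :
    F.cov4 (fun i j k l => s i j k l + t i j k l) m i j k l
      = F.cov4 s m i j k l + F.cov4 t m i j k l := by
  unfold cov4
  simp only [map_add, mul_add, Finset.sum_add_distrib]
  ring

lemma cov4_intCast_mul (c : ℤ) (t : Fin 4 → Fin 4 → Fin 4 → Fin 4 → A) (m i j k l : Fin 4) :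
    F.cov4 (fun i j k l => (c : A) * t i j k l) m i j k l = (c : A) * F.cov4 t m i j k l := by
  unfold cov4
  have : F.E m ((c : A)) = 0 := by simp
  simp only [Derivation.leibniz, this, smul_eq_mul, mul_sub, Finset.mul_sum]
  congr 1
  · simp
  · exact Finset.sum_congr rfl fun p _ => by ring

lemma cov2_mul_δ (s : A) (m j k : Fin 4) :
    F.cov2 (fun j k => s * δ A j k) m j k = F.E m s * δ A j k := by
  have h1 : ∑ p, F.Γ m j p * (s * δ A p k) = s * F.Γ m j k := by
    rw [← sum_mul_δ (F.Γ m j) k, Finset.mul_sum]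
    exact Finset.sum_congr rfl fun p _ => by ring
  have h2 : ∑ p, F.Γ m k p * (s * δ A j p) = s * F.Γ m k j := by
    rw [← sum_mul_δ' (F.Γ m k) j, Finset.mul_sum]
    exact Finset.sum_congr rfl fun p _ => by ring
  unfold cov2
  simp only [Finset.sum_add_distrib, h1, h2, Derivation.leibniz, E_δ, smul_eq_mul]
  rw [F.anti m j k]
  ring

/-- If the Weyl tensor is divergence free, then `Ric - R / 6 g` is a Codazzi tensor. -/
lemma codazzi (hW : ∀ j k l, ∑ i, F.cov4 F.weyl6 i i j k l = 0) (j k l : Fin 4) :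
    6 * (F.cov2 F.ric l k j - F.cov2 F.ric k l j)
      = F.E l F.sc * δ A j k - F.E k F.sc * δ A j l := by
  -- Written as a sum of integer multiples of elementary tensors, so that the covariant derivative
  -- can be taken termwise.
  have e1 : F.weyl6 = fun i j k l =>
      ((6 : ℤ) : A) * F.rm i j k l
        + (((-3 : ℤ) : A) * (F.ric j k * δ A i l)
        + (((-3 : ℤ) : A) * (F.ric i l * δ A j k)
        + (((3 : ℤ) : A) * (F.ric i k * δ A j l)
        + (((3 : ℤ) : A) * (F.ric j l * δ A i k)
        + (((1 : ℤ) : A) * ((F.sc * δ A j k) * δ A i l)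
        + ((-1 : ℤ) : A) * ((F.sc * δ A i k) * δ A j l)))))) := by
    funext i j k l
    unfold weyl6
    push_cast
    ring
  have h := hW j k l
  rw [e1] at h
  simp only [cov4_add, cov4_intCast_mul] at h
  simp only [F.cov4_mul_δ_outer F.ric, F.cov4_perm_inner F.ric, F.cov4_perm_even F.ric,
    F.cov4_perm_odd F.ric, F.cov4_mul_δ_outer (fun j k => F.sc * δ A j k),
    F.cov4_perm_even (fun j k => F.sc * δ A j k), cov2_mul_δ,
    Finset.sum_add_distrib, ← Finset.mul_sum, ← Finset.sum_mul,
    F.sum_cov4_rm_div] at h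
  have s1 : ∑ i, F.cov2 F.ric i j k * δ A i l = F.cov2 F.ric l j k := sum_mul_δ _ _
  have s2 : ∑ i, F.cov2 F.ric i j l * δ A i k = F.cov2 F.ric k j l := sum_mul_δ _ _
  have s3 : ∑ i, F.E i F.sc * δ A j k * δ A i l = F.E l F.sc * δ A j k :=
    sum_mul_δ (fun i => F.E i F.sc * δ A j k) l
  have s4 : ∑ i, F.E i F.sc * δ A i k = F.E k F.sc := sum_mul_δ _ _
  rw [s1, s2, s3, s4, F.cov2_ric_comm l j k, F.cov2_ric_comm k j l] at h
  -- The Ricci divergences left by the trace are replaced by half the derivative of the scalar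
  -- curvature, which fixes the factor on the right.
  push_cast at h
  linear_combination 2 * h + 3 * δ A j k * F.two_mul_sum_cov2_ric l
    - 3 * δ A j l * F.two_mul_sum_cov2_ric k

end FrameAlg

end FrameAlgebra

/-! ### Elimination theory for the principal curvatures along integral curves of `∇f`. -/

section LevelSetOde

/-- Differences of the Ricci equations eliminate `l` and `L`. With `t` the common value in `h1` and
`h2`, two of these differences are linear in `t ^ 2`, and eliminating `t ^ 2` leaves a relation
without `u`, `v`, `w`. -/
lemma curvature_relation_cubic {a b c u v w p l L : ℝ} (hab : a ≠ b) (hbc : b ≠ c) (hca : c ≠ a)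
    (h1 : u * (b - c) = v * (c - a)) (h2 : v * (c - a) = w * (a - b))
    (r1 : 3 * (L - p * a) = l + 6 * (v * w) - 3 * (a * b + a * c))
    (r2 : 3 * (L - p * b) = l + 6 * (w * u) - 3 * (b * c + b * a))
    (r3 : 3 * (L - p * c) = l + 6 * (u * v) - 3 * (c * a + c * b)) :
    (2 * (a + b + c) - 6 * p) * (a ^ 2 + b ^ 2 + c ^ 2 - a * b - b * c - c * a)
      = (2 * a - b - c) * (2 * b - a - c) * (2 * c - a - b) := by
  have hx : b - c ≠ 0 := sub_ne_zero.2 hbc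
  have hy : c - a ≠ 0 := sub_ne_zero.2 hca
  have hz : a - b ≠ 0 := sub_ne_zero.2 hab
  obtain ⟨t, ht⟩ : ∃ t, t = u * (b - c) := ⟨_, rfl⟩
  have hu : u = t / (b - c) := by field_simp; exact ht.symm
  have hv : v = t / (c - a) := by field_simp; linarith
  have hw : w = t / (a - b) := by field_simp; linarith
  have e1 : (p - c) * ((b - c) * (c - a) * (a - b) ^ 2) = 2 * t ^ 2 * ((c - a) - (b - c)) := by
    have : (p - c) * (a - b) = 2 * w * (u - v) := by linarith
    rw [hu, hv, hw] at this
    field_simp at this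
    linear_combination this
  have e2 : (p - a) * ((b - c) ^ 2 * (c - a) * (a - b)) = 2 * t ^ 2 * ((a - b) - (c - a)) := by
    have : (p - a) * (b - c) = 2 * u * (v - w) := by linarith
    rw [hu, hv, hw] at this
    field_simp at this
    linear_combination this
  have e3 : (b - c) * (c - a) * (a - b) * ((p - c) * (a - b) * ((a - b) - (c - a))
      - (p - a) * (b - c) * ((c - a) - (b - c))) = 0 := by
    linear_combination ((a - b) - (c - a)) * e1 - ((c - a) - (b - c)) * e2
  have e4 := (mul_eq_zero.1 e3).resolve_left (mul_ne_zero (mul_ne_zero hx hy) hz)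
  linear_combination -3 * e4

/-- The proportionality of `u`, `v`, `w` to the reciprocals of differences that sum to zero gives `u
* v + v * w + w * u = 0`, so these products drop out of the sum of the Ricci equations. -/
lemma curvature_relation_trace {a b c u v w p l L : ℝ} (hab : a ≠ b) (hbc : b ≠ c) (hca : c ≠ a)
    (h1 : u * (b - c) = v * (c - a)) (h2 : v * (c - a) = w * (a - b))
    (r1 : 3 * (L - p * a) = l + 6 * (v * w) - 3 * (a * b + a * c))
    (r2 : 3 * (L - p * b) = l + 6 * (w * u) - 3 * (b * c + b * a))
    (r3 : 3 * (L - p * c) = l + 6 * (u * v) - 3 * (c * a + c * b)) :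
    3 * L - p * (a + b + c) = l - 2 * (a * b + b * c + c * a) := by
  have hx : b - c ≠ 0 := sub_ne_zero.2 hbc
  have hy : c - a ≠ 0 := sub_ne_zero.2 hca
  have hz : a - b ≠ 0 := sub_ne_zero.2 hab
  have e : (b - c) * (c - a) * (u * v + v * w + w * u) = 0 := by
    linear_combination (u * (b - c)) * h2 - (w * (b - c)) * h1
  have e' := (mul_eq_zero.1 e).resolve_left (mul_ne_zero hx hy)
  linear_combination (r1 + r2 + r3) / 3 + 2 * e'

variable {A X : Type*} [CommRing A] [Algebra ℝ A] (ε : X → A →ₐ[ℝ] ℝ)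

/-- The functions `a`, `b`, `c`, `p`, `l` cannot satisfy the ordinary differential equations and
the algebraic relations which hold along the integral curves of `∇f`. -/
lemma level_set_ode_false (hsep : ∀ φ ψ : A, (∀ x, ε x φ = ε x ψ) → φ = ψ) (x₀ : X)
    (D : Derivation ℝ A A) (a b c p l : A) (L : ℝ)
    (ha : 3 * (D a + a ^ 2) = -l) (hb : 3 * (D b + b ^ 2) = -l) (hc : 3 * (D c + c ^ 2) = -l)
    (hp : D p = algebraMap ℝ A L - l)
    (hcub : (2 * (a + b + c) - 6 * p) * (a ^ 2 + b ^ 2 + c ^ 2 - a * b - b * c - c * a)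
      = (2 * a - b - c) * (2 * b - a - c) * (2 * c - a - b))
    (htr : 3 * algebraMap ℝ A L - p * (a + b + c) = l - 2 * (a * b + b * c + c * a))
    (hp0 : ∀ x, ε x p ≠ 0) (hab : ∀ x, ε x a ≠ ε x b) (hbc : ∀ x, ε x b ≠ ε x c)
    (hca : ∀ x, ε x c ≠ ε x a) : False := by
  have hL : D (algebraMap ℝ A L) = 0 := D.map_algebraMap L
  have n2 : D (2 : A) = 0 := by simpa using D.map_natCast 2
  have n4 : D (4 : A) = 0 := by simpa using D.map_natCast 4
  have n6 : D (6 : A) = 0 := by simpa using D.map_natCast 6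
  have n10 : D (10 : A) = 0 := by simpa using D.map_natCast 10
  have ev : ∀ x, ∀ {φ ψ : A}, φ = ψ → ε x φ = ε x ψ := fun x φ ψ h => by rw [h]
  have eL : ∀ x, ε x (algebraMap ℝ A L) = L := fun x => (ε x).commutes L
  -- First derivative: once the differential equations and the trace relation are inserted, the
  -- derivative of the cubic relation is, modulo that relation, a multiple of the positive quadratic
  -- form in `a - b`, `b - c`, `c - a`, which can be divided out.
  have s1 : algebraMap ℝ A L = 2 * p ^ 2 - (a * b + b * c + c * a) := by
    refine hsep _ _ fun x => ?_
    have d := ev x (congrArg D hcub)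
    have e1 := ev x ha
    have e2 := ev x hb
    have e3 := ev x hc
    have e4 := ev x hp
    have e5 := ev x hcub
    have e6 := ev x htr
    simp only [Derivation.leibniz, Derivation.leibniz_pow, map_add, map_sub, map_mul, map_pow,
      map_neg, smul_eq_mul, n2, n6, nsmul_eq_mul, map_ofNat, eL, map_zero, map_natCast]
      at d e1 e2 e3 e4 e5 e6 ⊢
    have h1 := hab x
    have h2 := hbc x
    generalize ε x (D a) = da at *
    generalize ε x (D b) = db at *
    generalize ε x (D c) = dc at *
    generalize ε x (D p) = dp at *
    generalize ε x a = a at *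
    generalize ε x b = b at *
    generalize ε x c = c at *
    generalize ε x p = p at *
    generalize ε x l = l at *
    have q0 : a ^ 2 + b ^ 2 + c ^ 2 - a * b - b * c - c * a ≠ 0 := by
      have : 0 < (a - b) ^ 2 := by
        have := sub_ne_zero.2 h1
        positivity
      nlinarith [sq_nonneg (b - c), sq_nonneg (c - a)]
    have hda : da = -a ^ 2 - l / 3 := by linarith
    have hdb : db = -b ^ 2 - l / 3 := by linarith
    have hdc : dc = -c ^ 2 - l / 3 := by linarith
    have hl : l = 3 * L - p * (a + b + c) + 2 * (a * b + b * c + c * a) := by linarith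
    subst hl
    subst hda hdb hdc e4
    have key : (a ^ 2 + b ^ 2 + c ^ 2 - a * b - b * c - c * a)
        * (L - (2 * p ^ 2 - (a * b + b * c + c * a))) = 0 := by
      linear_combination (d + ((6 * p - 2 * (a + b + c)) / 3 + 2 * (a + b + c)) * e5) / 6
    exact sub_eq_zero.1 ((mul_eq_zero.1 key).resolve_left q0)
  -- Second derivative: differentiating `s1` and reducing by the cubic relation leaves a factor `p`,
  -- which does not vanish.
  have s2 : algebraMap ℝ A L = 10 * p ^ 2 - 4 * (p * (a + b + c)) := by
    refine hsep _ _ fun x => ?_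
    have d := ev x (congrArg D s1)
    have e1 := ev x ha
    have e2 := ev x hb
    have e3 := ev x hc
    have e4 := ev x hp
    have e5 := ev x hcub
    have e6 := ev x htr
    have e7 := ev x s1
    simp only [Derivation.leibniz, Derivation.leibniz_pow, map_add, map_sub, map_mul, map_pow,
      map_neg, smul_eq_mul, n2, nsmul_eq_mul, map_ofNat, eL, hL, map_zero, map_natCast]
      at d e1 e2 e3 e4 e5 e6 e7 ⊢
    have p0 := hp0 x
    generalize ε x (D a) = da at *
    generalize ε x (D b) = db at *
    generalize ε x (D c) = dc at *
    generalize ε x (D p) = dp at *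
    generalize ε x a = a at *
    generalize ε x b = b at *
    generalize ε x c = c at *
    generalize ε x p = p at *
    generalize ε x l = l at *
    have hda : da = -a ^ 2 - l / 3 := by linarith
    have hdb : db = -b ^ 2 - l / 3 := by linarith
    have hdc : dc = -c ^ 2 - l / 3 := by linarith
    have hl : l = 3 * L - p * (a + b + c) + 2 * (a * b + b * c + c * a) := by linarith
    subst hl
    subst hda hdb hdc e4
    subst e7
    have key : p * (2 * p ^ 2 - (a * b + b * c + c * a)
        - (10 * p ^ 2 - 4 * (p * (a + b + c)))) = 0 := by
      linear_combination -d / 2 - e5 / 18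
    exact sub_eq_zero.1 ((mul_eq_zero.1 key).resolve_left p0)
  -- Third derivative, now at a single point: all symmetric functions become multiples of powers of
  -- `p`.
  have d := ev x₀ (congrArg D s2)
  have e1 := ev x₀ ha
  have e2 := ev x₀ hb
  have e3 := ev x₀ hc
  have e4 := ev x₀ hp
  have e5 := ev x₀ hcub
  have e6 := ev x₀ htr
  have e7 := ev x₀ s1
  have e8 := ev x₀ s2
  simp only [Derivation.leibniz, Derivation.leibniz_pow, map_add, map_sub, map_mul, map_pow,
    map_neg, smul_eq_mul, n4, n10, nsmul_eq_mul, map_ofNat, eL, hL, map_zero, map_natCast]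
    at d e1 e2 e3 e4 e5 e6 e7 e8
  have p0 := hp0 x₀
  have h1 := sub_ne_zero.2 (hab x₀)
  have h2 := sub_ne_zero.2 (hbc x₀)
  have h3 := sub_ne_zero.2 (hca x₀)
  generalize ε x₀ (D a) = da at *
  generalize ε x₀ (D b) = db at *
  generalize ε x₀ (D c) = dc at *
  generalize ε x₀ (D p) = dp at *
  generalize ε x₀ a = a at *
  generalize ε x₀ b = b at *
  generalize ε x₀ c = c at *
  generalize ε x₀ p = p at *
  generalize ε x₀ l = l at *
  have hda : da = -a ^ 2 - l / 3 := by linarith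
  have hdb : db = -b ^ 2 - l / 3 := by linarith
  have hdc : dc = -c ^ 2 - l / 3 := by linarith
  have hσ : a * b + b * c + c * a = 4 * (p * (a + b + c)) - 8 * p ^ 2 := by linarith
  have hl : l = 14 * p ^ 2 - 5 * (p * (a + b + c)) := by linarith
  have hdp : dp = p * (a + b + c) - 4 * p ^ 2 := by linarith
  have hds : da + db + dc = -(a + b + c) ^ 2 + 13 * (p * (a + b + c)) - 30 * p ^ 2 := by
    rw [hda, hdb, hdc, hl]
    linear_combination 2 * hσ
  have key : p ^ 2 * (5 * p - 2 * (a + b + c)) = 0 := by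
    have d' : 20 * p * dp - 4 * (p * (da + db + dc) + (a + b + c) * dp) = 0 := by
      linear_combination -d
    rw [hds, hdp] at d'
    linear_combination d' / 8
  have hs : a + b + c = 5 * p / 2 := by
    have := (mul_eq_zero.1 key).resolve_left (pow_ne_zero 2 p0)
    linarith
  have hq : a ^ 2 + b ^ 2 + c ^ 2 - a * b - b * c - c * a = p ^ 2 / 4 := by
    have : a ^ 2 + b ^ 2 + c ^ 2 - a * b - b * c - c * a
      = (a + b + c) ^ 2 - 3 * (a * b + b * c + c * a) := by ring
    rw [this, hσ, hs]
    ring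
  have hN : (2 * a - b - c) * (2 * b - a - c) * (2 * c - a - b) = -p ^ 3 / 4 := by
    rw [← e5, hq, hs]
    ring
  -- Classical expression of the discriminant of a cubic through its two invariants, whose values `p
  -- ^ 2 / 4` and `-p ^ 3 / 4` make it vanish.
  have hdisc : 27 * ((a - b) * (b - c) * (c - a)) ^ 2 = 0 := by
    have : 27 * ((a - b) * (b - c) * (c - a)) ^ 2
      = 4 * (a ^ 2 + b ^ 2 + c ^ 2 - a * b - b * c - c * a) ^ 3
        - ((2 * a - b - c) * (2 * b - a - c) * (2 * c - a - b)) ^ 2 := by ring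
    rw [this, hq, hN]
    ring
  have : (a - b) * (b - c) * (c - a) ≠ 0 := mul_ne_zero (mul_ne_zero h1 h2) h3
  exact this (pow_eq_zero_iff (two_ne_zero) |>.1 (by linarith))

end LevelSetOde

/-! ### The soliton and Codazzi equations in an adapted frame. -/

section SolitonAlgebra

/-- The algebraic data of a gradient Ricci soliton with harmonic Weyl curvature in an adapted frame:
`p = |∇f|`, the `ev i` are the Ricci eigenfunctions and `ε x` is the evaluation at `x`. The
functions `ev 1`, `ev 2`, `ev 3` are assumed to be distinct at each point. -/
structure SolitonAlg (A X : Type*) [CommRing A] [Algebra ℝ A] extends FrameAlg A where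
  ε : X → A →ₐ[ℝ] ℝ
  sep : ∀ φ ψ : A, (∀ x, ε x φ = ε x ψ) → φ = ψ
  ev : Fin 4 → A
  p : A
  lam : ℝ
  ric_eq : ∀ i j, toFrameAlg.ric i j = ev i * FrameAlg.δ A i j
  hess_eq : ∀ i j, E i (p * FrameAlg.δ A j 0) + p * Γ i 0 j
    = (algebraMap ℝ A lam - ev i) * FrameAlg.δ A i j
  div_weyl : ∀ j k l, ∑ i, toFrameAlg.cov4 toFrameAlg.weyl6 i i j k l = 0
  p_ne : ∀ x, ε x p ≠ 0
  ev_ne : ∀ x i j, i ≠ 0 → j ≠ 0 → i ≠ j → ε x (ev i) ≠ ε x (ev j)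

namespace SolitonAlg

open FrameAlg

variable {A X : Type*} [CommRing A] [Algebra ℝ A] (S : SolitonAlg A X)

/-- A nowhere vanishing element need not be inverted: evaluations separate elements, so it can be
cancelled pointwise. -/
lemma cancel {φ ψ : A} (hφ : ∀ x, S.ε x φ ≠ 0) (h : φ * ψ = 0) : ψ = 0 := by
  refine S.sep _ _ fun x => ?_
  have := congrArg (S.ε x) h
  rw [map_mul, map_zero] at this
  rw [map_zero]
  exact (mul_eq_zero.1 this).resolve_left (hφ x)

lemma δ_self (i : Fin 4) : δ A i i = 1 := if_pos rfl

lemma δ_ne {i j : Fin 4} (h : i ≠ j) : δ A i j = 0 := if_neg h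

lemma Γ_self (i j : Fin 4) : S.Γ i j j = 0 := by
  refine ofNat_mul_cancel 2 ?_
  linear_combination S.anti i j j

lemma E_p (i : Fin 4) : S.E i S.p = (algebraMap ℝ A S.lam - S.ev i) * δ A i 0 := by
  have h := S.hess_eq i 0
  rw [S.Γ_self, δ_self] at h
  simpa using h

lemma E_p_of_ne {i : Fin 4} (hi : i ≠ 0) : S.E i S.p = 0 := by
  rw [S.E_p, δ_ne hi, mul_zero]

lemma E_zero_p : S.E 0 S.p = algebraMap ℝ A S.lam - S.ev 0 := by
  rw [S.E_p, δ_self, mul_one]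

/-- The diagonal of the Hessian: `S.Γ i 0 i` is the principal curvature of the level hypersurface in
direction `i`. -/
lemma p_mul_Γ {i : Fin 4} (hi : i ≠ 0) : S.p * S.Γ i 0 i = algebraMap ℝ A S.lam - S.ev i := by
  have h := S.hess_eq i i
  rw [δ_ne hi, δ_self] at h
  simpa using h

lemma Γ_zero_right {i j : Fin 4} (hij : i ≠ j ∨ j = 0) : S.Γ i 0 j = 0 := by
  by_cases hj : j = 0
  · rw [hj, S.Γ_self]
  · have h := S.hess_eq i j
    rw [δ_ne hj, δ_ne (hij.resolve_right hj)] at h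
    exact S.cancel S.p_ne (by simpa using h)

lemma Γ_right_zero {i j : Fin 4} (hij : i ≠ j ∨ j = 0) : S.Γ i j 0 = 0 := by
  rw [S.anti, S.Γ_zero_right hij, neg_zero]

/-- In an eigenframe `∇Ric` has derivatives of eigenvalues on the diagonal and Christoffel symbols
times eigenvalue differences off it; every later use picks an index pattern. -/
lemma codazzi_eigen (j k l : Fin 4) :
    6 * (S.E l (S.ev k) * δ A k j + S.Γ l k j * (S.ev k - S.ev j)
      - (S.E k (S.ev l) * δ A l j + S.Γ k l j * (S.ev l - S.ev j)))
      = S.E l S.sc * δ A j k - S.E k S.sc * δ A j l := by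
  have hc : ∀ m j k, S.cov2 S.ric m j k
      = S.E m (S.ev j) * δ A j k + S.Γ m j k * (S.ev j - S.ev k) := by
    intro m j k
    have h1 : ∑ q, S.Γ m j q * (S.ev q * δ A q k) = S.Γ m j k * S.ev k := by
      rw [← sum_mul_δ (fun q => S.Γ m j q * S.ev q) k]
      exact Finset.sum_congr rfl fun q _ => by ring
    have h2 : ∑ q, S.Γ m k q * (S.ev j * δ A j q) = S.Γ m k j * S.ev j := by
      rw [← sum_mul_δ' (fun q => S.Γ m k q * S.ev j) j]
      exact Finset.sum_congr rfl fun q _ => by ring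
    unfold cov2
    simp only [S.ric_eq, Finset.sum_add_distrib, h1, h2, Derivation.leibniz, E_δ, smul_eq_mul]
    rw [S.anti m k j]
    ring
  rw [← hc, ← hc]
  exact S.codazzi S.div_weyl j k l

/-- Commute `S.E i` and `S.E 0` on `S.p`: the bracket has no `e 0` component, and `S.p` is constant
in the other directions. -/
lemma E_ev_zero {i : Fin 4} (hi : i ≠ 0) : S.E i (S.ev 0) = 0 := by
  have h := S.comm i 0 S.p
  have h1 : ∀ k, (S.Γ i 0 k - S.Γ 0 i k) * S.E k S.p = 0 := by
    intro k
    by_cases hk : k = 0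
    · rw [hk, S.Γ_self, S.Γ_right_zero (Or.inl hi.symm)]; ring
    · rw [S.E_p_of_ne hk, mul_zero]
  rw [Finset.sum_eq_zero fun k _ => h1 k, S.E_zero_p, S.E_p_of_ne hi, map_sub, map_zero,
    Derivation.map_algebraMap] at h
  linear_combination -h

lemma E_sc {i : Fin 4} (hi : i ≠ 0) : S.E i S.sc = 0 := by
  have h := S.codazzi_eigen 0 0 i
  rw [S.E_ev_zero hi, S.Γ_self, S.Γ_right_zero (Or.inl hi.symm), δ_self, δ_ne hi,
    δ_ne hi.symm] at h
  linear_combination -h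

/-- The normal curves are geodesics by the Hessian equation, and for tangential `i`, `j` the Codazzi
equation leaves only `S.Γ 0 i j` times an eigenvalue difference that never vanishes. -/
lemma Γ_zero_left (i j : Fin 4) : S.Γ 0 i j = 0 := by
  by_cases hi : i = 0
  · rw [hi]
    by_cases hj : j = 0
    · rw [hj, S.Γ_self]
    · exact S.Γ_zero_right (Or.inl (Ne.symm hj))
  by_cases hj : j = 0
  · rw [hj]; exact S.Γ_right_zero (Or.inl (Ne.symm hi))
  by_cases hij : i = j
  · rw [hij, S.Γ_self]
  have h := S.codazzi_eigen j i 0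
  rw [δ_ne hij, δ_ne (Ne.symm hj), δ_ne (Ne.symm hij), δ_ne hj, S.Γ_zero_right (Or.inl hij)] at h
  have h2 : (S.ev i - S.ev j) * S.Γ 0 i j = 0 := by
    refine ofNat_mul_cancel 6 ?_
    linear_combination h
  refine S.cancel (fun x => ?_) h2
  rw [map_sub]
  exact sub_ne_zero.2 (S.ev_ne x i j hi hj hij)

/-- The Codazzi equation in a radial plane combined with the radial derivative of `p_mul_Γ`; the
right side does not depend on `i`. -/
lemma six_mul_p_mul {i : Fin 4} (hi : i ≠ 0) :
    6 * (S.p * (S.E 0 (S.Γ i 0 i) + S.Γ i 0 i ^ 2)) = -S.E 0 S.sc := by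
  have h := S.codazzi_eigen i i 0
  have hp := S.p_mul_Γ hi
  have hd := congrArg (S.E 0) hp
  rw [Derivation.leibniz, map_sub, Derivation.map_algebraMap, S.E_zero_p] at hd
  rw [δ_self, δ_ne (Ne.symm hi), δ_ne hi, S.Γ_self] at h
  simp only [smul_eq_mul] at hd
  linear_combination -h + 6 * hd + 6 * S.Γ i 0 i * hp

lemma rm_zero (i : Fin 4) :
    S.rm i 0 0 i = -(S.E 0 (S.Γ i 0 i) + S.Γ i 0 i ^ 2) := by
  have h1 : ∑ m, (S.Γ 0 0 m * S.Γ i m i - S.Γ i 0 m * S.Γ 0 m i) = 0 :=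
    Finset.sum_eq_zero fun m _ => by rw [S.Γ_zero_left, S.Γ_zero_left]; ring
  have h2 : ∑ m, (S.Γ i 0 m - S.Γ 0 i m) * S.Γ m 0 i = S.Γ i 0 i ^ 2 := by
    rw [Finset.sum_eq_single i]
    · rw [S.Γ_zero_left]; ring
    · intro m _ hm
      rw [S.Γ_zero_right (i := m) (Or.inl hm), mul_zero]
    · simp
  unfold rm
  rw [h1, h2, S.Γ_zero_left, map_zero]
  ring

lemma rm_zero_zero : S.rm 0 0 0 0 = 0 := by
  refine ofNat_mul_cancel 2 ?_
  linear_combination S.rm_swap 0 0 0 0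

/-- The Riccati equation for the principal curvatures of the level hypersurfaces of `f`. -/
lemma riccati {i : Fin 4} (hi : i ≠ 0) :
    3 * (S.E 0 (S.Γ i 0 i) + S.Γ i 0 i ^ 2) = -S.ev 0 := by
  have h0 := S.ric_eq 0 0
  rw [δ_self, ric, Fin.sum_univ_four, S.rm_zero_zero, S.rm_zero 1,
    S.rm_zero 2, S.rm_zero 3] at h0
  have h1 := S.six_mul_p_mul (i := 1) (by decide)
  have h2 := S.six_mul_p_mul (i := 2) (by decide)
  have h3 := S.six_mul_p_mul (i := 3) (by decide)
  have hi' := S.six_mul_p_mul hi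
  -- The radial sectional curvatures are equal and sum to `S.ev 0`, so each is a third of it.
  have key : S.p * (3 * (S.E 0 (S.Γ i 0 i) + S.Γ i 0 i ^ 2) + S.ev 0) = 0 := by
    refine ofNat_mul_cancel 6 ?_
    linear_combination 3 * hi' - h1 - h2 - h3 - 6 * S.p * h0
  linear_combination S.cancel S.p_ne key

/-- The bracket of `e i` with `e 0` is a multiple of `e i`, so constancy along level sets survives
radial differentiation. -/
lemma E_E_zero {i : Fin 4} {φ : A} (hφ : S.E i φ = 0) : S.E i (S.E 0 φ) = 0 := by
  have h := S.comm i 0 φ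
  have h1 : ∀ k, (S.Γ i 0 k - S.Γ 0 i k) * S.E k φ = 0 := by
    intro k
    by_cases hk : i = k
    · rw [← hk, hφ, mul_zero]
    · rw [S.Γ_zero_right (Or.inl hk), S.Γ_zero_left]; ring
  rw [Finset.sum_eq_zero fun k _ => h1 k, hφ, map_zero, sub_zero] at h
  exact h

lemma Γ_ne (x : X) {i j : Fin 4} (hi : i ≠ 0) (hj : j ≠ 0) (hij : i ≠ j) :
    S.ε x (S.Γ i 0 i) ≠ S.ε x (S.Γ j 0 j) := by
  intro h
  have h1 := congrArg (S.ε x) (S.p_mul_Γ hi)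
  have h2 := congrArg (S.ε x) (S.p_mul_Γ hj)
  rw [map_mul, map_sub] at h1 h2
  rw [h, h2] at h1
  exact S.ev_ne x i j hi hj hij (by linarith)

/-- Testing against the polynomial `(X - b) * (X - c)` isolates `α`. -/
lemma vandermonde {a b c α β γ : A} (h0 : α + β + γ = 0) (h1 : a * α + b * β + c * γ = 0)
    (h2 : a ^ 2 * α + b ^ 2 * β + c ^ 2 * γ = 0) (hab : ∀ x, S.ε x a ≠ S.ε x b)
    (hac : ∀ x, S.ε x a ≠ S.ε x c) : α = 0 := by
  have h : (a - b) * ((a - c) * α) = 0 := by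
    linear_combination h2 - (b + c) * h1 + b * c * h0
  have h' := S.cancel (fun x => by rw [map_sub]; exact sub_ne_zero.2 (hab x)) h
  exact S.cancel (fun x => by rw [map_sub]; exact sub_ne_zero.2 (hac x)) h'

lemma sc_eq : S.sc = S.ev 0 + S.ev 1 + S.ev 2 + S.ev 3 := by
  unfold sc
  simp only [S.ric_eq, δ_self, mul_one, Fin.sum_univ_four]

/-- The power sums of the principal curvatures are constant along the level hypersurfaces. -/
lemma E_power_sums {i : Fin 4} (hi : i ≠ 0) :
    S.E i (S.Γ 1 0 1) + S.E i (S.Γ 2 0 2) + S.E i (S.Γ 3 0 3) = 0 ∧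
    S.Γ 1 0 1 * S.E i (S.Γ 1 0 1) + S.Γ 2 0 2 * S.E i (S.Γ 2 0 2)
      + S.Γ 3 0 3 * S.E i (S.Γ 3 0 3) = 0 ∧
    S.Γ 1 0 1 ^ 2 * S.E i (S.Γ 1 0 1) + S.Γ 2 0 2 ^ 2 * S.E i (S.Γ 2 0 2)
      + S.Γ 3 0 3 ^ 2 * S.E i (S.Γ 3 0 3) = 0 := by
  have r1 := S.riccati (i := 1) (by decide)
  have r2 := S.riccati (i := 2) (by decide)
  have r3 := S.riccati (i := 3) (by decide)
  have p1 := S.p_mul_Γ (i := 1) (by decide)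
  have p2 := S.p_mul_Γ (i := 2) (by decide)
  have p3 := S.p_mul_Γ (i := 3) (by decide)
  have hev := S.E_ev_zero hi
  have hsc := S.E_sc hi
  have hp := S.E_p_of_ne hi
  have hs := S.sc_eq
  generalize S.Γ 1 0 1 = a at *
  generalize S.Γ 2 0 2 = b at *
  generalize S.Γ 3 0 3 = c at *
  have n3 : S.E i (3 : A) = 0 := by simpa using (S.E i).map_natCast 3
  have n6 : S.E i (6 : A) = 0 := by simpa using (S.E i).map_natCast 6
  have n2 : S.E i (2 : A) = 0 := by simpa using (S.E i).map_natCast 2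
  -- The first power sum is controlled by the trace of the Hessian; each further one is, up to
  -- functions already known to be constant on level sets, the radial derivative of its predecessor.
  have t0 : S.E i (a + b + c) = 0 := by
    have h : S.p * (a + b + c) = 3 * algebraMap ℝ A S.lam - (S.sc - S.ev 0) := by
      rw [hs]; linear_combination p1 + p2 + p3
    have h' := congrArg (S.E i) h
    simp only [Derivation.leibniz, map_sub, Derivation.map_algebraMap, hp, hsc, hev, n3,
      smul_eq_mul] at h'
    refine S.cancel S.p_ne ?_
    linear_combination h'
  have t1 : S.E i (a ^ 2 + b ^ 2 + c ^ 2) = 0 := by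
    have h : 3 * (a ^ 2 + b ^ 2 + c ^ 2) = -(3 * S.ev 0) - 3 * S.E 0 (a + b + c) := by
      simp only [map_add]; linear_combination r1 + r2 + r3
    have h' := congrArg (S.E i) h
    simp only [Derivation.leibniz, map_sub, map_neg, hev, n3, S.E_E_zero t0, smul_eq_mul] at h'
    refine ofNat_mul_cancel 3 ?_
    linear_combination h'
  have t2 : S.E i (a ^ 3 + b ^ 3 + c ^ 3) = 0 := by
    have h : 6 * (a ^ 3 + b ^ 3 + c ^ 3)
        = -(3 * S.E 0 (a ^ 2 + b ^ 2 + c ^ 2)) - 2 * (S.ev 0 * (a + b + c)) := by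
      simp only [map_add, Derivation.leibniz_pow, nsmul_eq_mul, smul_eq_mul]
      push_cast
      linear_combination 2 * a * r1 + 2 * b * r2 + 2 * c * r3
    have h' := congrArg (S.E i) h
    simp only [Derivation.leibniz, map_sub, map_neg, hev, n3, n2, n6, S.E_E_zero t1, t0,
      smul_eq_mul] at h'
    refine ofNat_mul_cancel 6 ?_
    linear_combination h'
  simp only [map_add, Derivation.leibniz_pow, nsmul_eq_mul, smul_eq_mul] at t0 t1 t2
  push_cast at t1 t2
  refine ⟨t0, ofNat_mul_cancel 2 ?_, ofNat_mul_cancel 3 ?_⟩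
  · linear_combination t1
  · linear_combination t2

/-- The principal curvatures are constant along the level hypersurfaces. -/
lemma E_Γ {i j : Fin 4} (hi : i ≠ 0) (hj : j ≠ 0) : S.E i (S.Γ j 0 j) = 0 := by
  obtain ⟨h0, h1, h2⟩ := S.E_power_sums hi
  have d := fun (k l : Fin 4) hk hl hkl x => S.Γ_ne x (i := k) (j := l) hk hl hkl
  have k1 : S.E i (S.Γ 1 0 1) = 0 :=
    S.vandermonde h0 h1 h2 (d 1 2 (by decide) (by decide) (by decide))
      (d 1 3 (by decide) (by decide) (by decide))
  have k2 : S.E i (S.Γ 2 0 2) = 0 := by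
    refine S.vandermonde (a := S.Γ 2 0 2) (b := S.Γ 1 0 1) (c := S.Γ 3 0 3)
      (β := S.E i (S.Γ 1 0 1)) (γ := S.E i (S.Γ 3 0 3)) ?_ ?_ ?_
      (d 2 1 (by decide) (by decide) (by decide)) (d 2 3 (by decide) (by decide) (by decide))
    · linear_combination h0
    · linear_combination h1
    · linear_combination h2
  have k3 : S.E i (S.Γ 3 0 3) = 0 := by
    rw [k1, k2] at h0
    linear_combination h0
  fin_cases j
  · exact absurd rfl hj
  · exact k1
  · exact k2
  · exact k3

lemma E_ev {i j : Fin 4} (hi : i ≠ 0) (hj : j ≠ 0) : S.E i (S.ev j) = 0 := by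
  have h := congrArg (S.E i) (S.p_mul_Γ hj)
  rw [Derivation.leibniz, S.E_Γ hi hj, S.E_p_of_ne hi, map_sub, Derivation.map_algebraMap] at h
  simp only [smul_zero, zero_sub] at h
  linear_combination h

/-- With all eigenvalues constant on level sets, the Codazzi equation leaves only the symbol times a
nonvanishing eigenvalue difference. -/
lemma Γ_repeat {i j : Fin 4} (hi : i ≠ 0) (hj : j ≠ 0) : S.Γ j i j = 0 := by
  by_cases hij : i = j
  · rw [hij, S.Γ_self]
  have h := S.codazzi_eigen j j i
  rw [S.E_ev hi hj, S.E_sc hi, S.Γ_self, δ_self, δ_ne hij, δ_ne (Ne.symm hij)] at h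
  have h2 : (S.ev i - S.ev j) * S.Γ j i j = 0 := by
    refine ofNat_mul_cancel 6 ?_
    linear_combination -h
  refine S.cancel (fun x => ?_) h2
  rw [map_sub]
  exact sub_ne_zero.2 (S.ev_ne x i j hi hj hij)

lemma Γ_repeat' {i j : Fin 4} (hi : i ≠ 0) (hj : j ≠ 0) : S.Γ j j i = 0 := by
  rw [S.anti, S.Γ_repeat hi hj, neg_zero]

/-- Off the diagonal the Codazzi equation has no derivative terms; eigenvalue differences are `-S.p`
times differences of principal curvatures, and `S.p` cancels. -/
lemma Γ_distinct {l k j : Fin 4} (hl : l ≠ 0) (hk : k ≠ 0) (hj : j ≠ 0) (hkj : k ≠ j)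
    (hlj : l ≠ j) :
    S.Γ l k j * (S.Γ k 0 k - S.Γ j 0 j) = S.Γ k l j * (S.Γ l 0 l - S.Γ j 0 j) := by
  have h := S.codazzi_eigen j k l
  rw [δ_ne hkj, δ_ne hlj, δ_ne hkj.symm, δ_ne hlj.symm] at h
  refine sub_eq_zero.1 (S.cancel S.p_ne (ofNat_mul_cancel 6 ?_))
  linear_combination -h + 6 * S.Γ l k j * (S.p_mul_Γ hk - S.p_mul_Γ hj)
    - 6 * S.Γ k l j * (S.p_mul_Γ hl - S.p_mul_Γ hj)

/-- The sectional curvatures tangent to the level hypersurfaces. -/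
lemma rm_tangent {i j k : Fin 4} (hi : i ≠ 0) (hj : j ≠ 0) (hk : k ≠ 0) (hij : i ≠ j)
    (hjk : j ≠ k) (hik : i ≠ k) (huniv : (Finset.univ : Finset (Fin 4)) = {0, i, j, k}) :
    S.rm j i i j = -(S.Γ i 0 i * S.Γ j 0 j) - S.Γ i j k * S.Γ j k i
      + (S.Γ i j k + S.Γ j k i) * S.Γ k i j := by
  have hs : ∀ g : Fin 4 → A, ∑ m, g m = g 0 + g i + g j + g k := by
    intro g
    rw [huniv, Finset.sum_insert (by simp [hi.symm, hj.symm, hk.symm]),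
      Finset.sum_insert (by simp [hij, hik]), Finset.sum_insert (by simp [hjk]),
      Finset.sum_singleton]
    ring
  unfold rm
  rw [hs, hs, S.Γ_repeat' hj hi, S.Γ_repeat hi hj, map_zero, map_zero]
  have e1 : S.Γ i i 0 = -S.Γ i 0 i := S.anti i i 0
  have e2 : S.Γ j i 0 = 0 := S.Γ_right_zero (Or.inl hij.symm)
  have e3 : S.Γ i j 0 = 0 := S.Γ_right_zero (Or.inl hij)
  rw [S.Γ_self j i, S.Γ_self i j, S.Γ_self i i, S.Γ_self j j, S.Γ_repeat hj hi,
    S.Γ_repeat' hk hi, e1, e2, e3, S.anti j i k, S.anti i k j]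
  ring

lemma ric_tangent {i : Fin 4} (hi : i ≠ 0) :
    3 * (algebraMap ℝ A S.lam - S.p * S.Γ i 0 i) = 3 * ∑ m, S.rm m i i m := by
  have h := S.ric_eq i i
  rw [δ_self, ric] at h
  rw [S.p_mul_Γ hi, h]
  ring

lemma three_mul_rm_zero {i : Fin 4} (hi : i ≠ 0) : 3 * S.rm 0 i i 0 = S.ev 0 := by
  rw [S.rm_swap, S.rm_swap', S.rm_zero]
  linear_combination -S.riccati hi

lemma rm_self_left (i k l : Fin 4) : S.rm i i k l = 0 := by
  refine ofNat_mul_cancel 2 ?_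
  linear_combination S.rm_swap i i k l

/-- The Ricci eigenvalues along a level hypersurface cannot be pairwise distinct at each point. -/
theorem elim (S : SolitonAlg A X) (x₀ : X) : False := by
  have n1 : (1 : Fin 4) ≠ 0 := by decide
  have n2 : (2 : Fin 4) ≠ 0 := by decide
  have n3 : (3 : Fin 4) ≠ 0 := by decide
  have c1 := S.Γ_distinct n1 n2 n3 (by decide) (by decide)
  have c2 := S.Γ_distinct n2 n3 n1 (by decide) (by decide)
  rw [S.anti 2 1 3] at c1
  rw [S.anti 3 2 1] at c2
  have k12 := S.rm_tangent n1 n2 n3 (by decide) (by decide) (by decide) (by decide)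
  have k23 := S.rm_tangent n2 n3 n1 (by decide) (by decide) (by decide) (by decide)
  have k31 := S.rm_tangent n3 n1 n2 (by decide) (by decide) (by decide) (by decide)
  have sw : ∀ i j, S.rm i j j i = S.rm j i i j := fun i j => by
    rw [S.rm_swap, S.rm_swap', neg_neg]
  have r1 := S.ric_tangent n1
  have r2 := S.ric_tangent n2
  have r3 := S.ric_tangent n3
  rw [Fin.sum_univ_four, S.rm_self_left] at r1 r2 r3
  rw [k12, sw 3 1, k31] at r1
  rw [sw 1 2, k12, k23] at r2
  rw [k31, sw 2 3, k23] at r3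
  have z1 := S.three_mul_rm_zero n1
  have z2 := S.three_mul_rm_zero n2
  have z3 := S.three_mul_rm_zero n3
  have a12 := fun x => S.Γ_ne x n1 n2 (by decide)
  have a23 := fun x => S.Γ_ne x n2 n3 (by decide)
  have a31 := fun x => S.Γ_ne x n3 n1 (by decide)
  have q1 := S.riccati n1
  have q2 := S.riccati n2
  have q3 := S.riccati n3
  generalize S.Γ 1 0 1 = a at *
  generalize S.Γ 2 0 2 = b at *
  generalize S.Γ 3 0 3 = c at *
  generalize S.Γ 1 2 3 = u at *
  generalize S.Γ 2 3 1 = v at *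
  generalize S.Γ 3 1 2 = w at *
  have h1 : u * (b - c) = v * (c - a) := by linear_combination c1
  have h2 : v * (c - a) = w * (a - b) := by linear_combination c2
  -- In each Ricci sum two tangential sectional curvatures combine so that of the products of `u`,
  -- `v`, `w` only one survives, with coefficient 2.
  have s1 : 3 * (algebraMap ℝ A S.lam - S.p * a)
      = S.ev 0 + 6 * (v * w) - 3 * (a * b + a * c) := by linear_combination r1 + z1
  have s2 : 3 * (algebraMap ℝ A S.lam - S.p * b)
      = S.ev 0 + 6 * (w * u) - 3 * (b * c + b * a) := by linear_combination r2 + z2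
  have s3 : 3 * (algebraMap ℝ A S.lam - S.p * c)
      = S.ev 0 + 6 * (u * v) - 3 * (c * a + c * b) := by linear_combination r3 + z3
  have eL : ∀ x, S.ε x (algebraMap ℝ A S.lam) = S.lam := fun x => (S.ε x).commutes _
  refine level_set_ode_false S.ε S.sep x₀ (S.E 0) a b c S.p (S.ev 0) S.lam q1 q2 q3 S.E_zero_p
    (S.sep _ _ fun x => ?_) (S.sep _ _ fun x => ?_) S.p_ne a12 a23 a31
  all_goals
    have t1 := congrArg (S.ε x) h1
    have t2 := congrArg (S.ε x) h2
    have v1 := congrArg (S.ε x) s1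
    have v2 := congrArg (S.ε x) s2
    have v3 := congrArg (S.ε x) s3
    simp only [map_add, map_sub, map_mul, map_ofNat, map_pow, eL] at t1 t2 v1 v2 v3 ⊢
  · exact curvature_relation_cubic (a12 x) (a23 x) (a31 x) t1 t2 v1 v2 v3
  · exact curvature_relation_trace (a12 x) (a23 x) (a31 x) t1 t2 v1 v2 v3

end SolitonAlg

end SolitonAlgebra

/-! ### Smooth functions on `U` as a real algebra, with vector fields as derivations. -/

section SmoothFunctions

variable {M : Type*} [TopologicalSpace M] [ChartedSpace (EuclideanSpace ℝ (Fin 4)) M]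
  [IsManifold (𝓡 4) ∞ M]

open Classical in
/-- The extension by zero of a function on `U`. -/
def extZero {U : Set M} (φ : U → ℝ) (x : M) : ℝ := if h : x ∈ U then φ ⟨x, h⟩ else 0

lemma extZero_of_mem {U : Set M} (φ : U → ℝ) {x : M} (hx : x ∈ U) : extZero φ x = φ ⟨x, hx⟩ :=
  dif_pos hx

/-- The derivations of a commutative algebra. -/
abbrev Der (A : Type*) [CommRing A] [Algebra ℝ A] : Type _ := Derivation ℝ A A

/-- The algebra of smooth functions on `U`. -/
def smoothAlg (U : Set M) : Subalgebra ℝ (U → ℝ) where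
  carrier := {φ | SmoothOn 4 (extZero φ) U}
  mul_mem' {φ ψ} hφ hψ := (ContMDiffOn.mul hφ hψ).congr fun x hx => by
    simp [extZero_of_mem _ hx]
  add_mem' {φ ψ} hφ hψ := (ContMDiffOn.add hφ hψ).congr fun x hx => by
    simp [extZero_of_mem _ hx]
  algebraMap_mem' r := (contMDiffOn_const (c := r)).congr fun x hx => by
    simp [extZero_of_mem _ hx]

namespace smoothAlg

variable {U : Set M}

lemma smoothOn_extZero (φ : smoothAlg U) : SmoothOn 4 (extZero φ.1) U := φ.2

/-- The restriction to `U` of a function which is smooth on `U`. -/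
def restrict (φ : M → ℝ) (h : SmoothOn 4 φ U) : smoothAlg U :=
  ⟨fun x => φ x, ContMDiffOn.congr h fun _ hx => extZero_of_mem _ hx⟩

/-- The evaluation at a point. -/
def eval (x : U) : smoothAlg U →ₐ[ℝ] ℝ := (Pi.evalAlgHom ℝ (fun _ : U => ℝ) x).comp (Subalgebra.val _)

lemma eval_restrict (x : U) (φ : M → ℝ) (h : SmoothOn 4 φ U) : eval x (restrict φ h) = φ x := rfl

lemma eval_extZero {x : M} (hx : x ∈ U) (φ : smoothAlg U) : extZero φ.1 x = eval ⟨x, hx⟩ φ :=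
  extZero_of_mem _ hx

lemma ext_eval {φ ψ : smoothAlg U} (h : ∀ x, eval x φ = eval x ψ) : φ = ψ :=
  Subtype.ext (funext h)

lemma restrict_extZero (φ : smoothAlg U) : restrict (extZero φ.1) (smoothOn_extZero φ) = φ :=
  ext_eval fun x => eval_extZero x.2 φ

lemma extZero_restrict (hU : IsOpen U) (φ : M → ℝ) (h : SmoothOn 4 φ U) {x : M} (hx : x ∈ U) :
    extZero (restrict φ h).1 =ᶠ[𝓝 x] φ := by
  filter_upwards [hU.mem_nhds hx] with y hy
  exact extZero_of_mem _ hy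

/-- The derivation along a smooth vector field. -/
def derivation (hU : IsOpen U) (X : ∀ x : M, Tan 4 x) (hX : SmoothFieldOn X U) :
    Der (smoothAlg U) :=
  have hmul : ∀ φ ψ : smoothAlg U, restrict _ (smoothOn_dirDeriv hU (smoothOn_extZero (φ * ψ)) hX)
      = φ * restrict _ (smoothOn_dirDeriv hU (smoothOn_extZero ψ) hX)
        + ψ * restrict _ (smoothOn_dirDeriv hU (smoothOn_extZero φ) hX) := fun φ ψ => ext_eval fun x => by
    have h : extZero (φ * ψ).1 =ᶠ[𝓝 x.1] fun y => extZero φ.1 y * extZero ψ.1 y := by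
      filter_upwards [hU.mem_nhds x.2] with y hy
      rw [eval_extZero hy, eval_extZero hy, eval_extZero hy, map_mul]
    simp only [map_add, map_mul, eval_restrict]
    rw [dirDeriv_congr h, dirDeriv_mul ((smoothOn_extZero φ).diffFun hU x.2) ((smoothOn_extZero ψ).diffFun hU x.2),
      eval_extZero x.2, eval_extZero x.2]
  have hconst : ∀ r : ℝ, restrict _ (smoothOn_dirDeriv hU (smoothOn_extZero (algebraMap ℝ (smoothAlg U) r)) hX)
      = 0 := fun r => ext_eval fun x => by
    have h : extZero (algebraMap ℝ (smoothAlg U) r).1 =ᶠ[𝓝 x.1] fun _ => r := by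
      filter_upwards [hU.mem_nhds x.2] with y hy
      rw [eval_extZero hy, AlgHom.commutes]; rfl
    rw [eval_restrict, dirDeriv_congr h, dirDeriv_const, map_zero]
  Derivation.mk'
    { toFun := fun φ => restrict _ (smoothOn_dirDeriv hU (smoothOn_extZero φ) hX)
      map_add' := fun φ ψ => ext_eval fun x => by
        have h : extZero (φ + ψ).1 =ᶠ[𝓝 x.1] fun y => extZero φ.1 y + extZero ψ.1 y := by
          filter_upwards [hU.mem_nhds x.2] with y hy
          rw [eval_extZero hy, eval_extZero hy, eval_extZero hy, map_add]
        simp only [map_add, eval_restrict]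
        rw [dirDeriv_congr h,
          dirDeriv_add ((smoothOn_extZero φ).diffFun hU x.2) ((smoothOn_extZero ψ).diffFun hU x.2)]
      -- Homogeneity comes from the Leibniz rule, as scalars act through constant functions.
      map_smul' := fun r φ => by
        simp only [Algebra.smul_def, RingHom.id_apply]
        rw [hmul, hconst, mul_zero, add_zero] }
    hmul

lemma derivation_restrict (hU : IsOpen U) (X : ∀ x : M, Tan 4 x) (hX : SmoothFieldOn X U)
    (φ : M → ℝ) (h : SmoothOn 4 φ U) :
    derivation hU X hX (restrict φ h) = restrict _ (smoothOn_dirDeriv hU h hX) :=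
  ext_eval fun x => dirDeriv_congr (extZero_restrict hU φ h x.2) _

end smoothAlg

end SmoothFunctions

/-! ### The geometric model of the algebraic structures. -/

section FrameData

variable {M : Type*} [TopologicalSpace M] [ChartedSpace (EuclideanSpace ℝ (Fin 4)) M]
  [IsManifold (𝓡 4) ∞ M] [RiemannianBundle (fun x : M => TangentSpace (𝓡 4) x)]
  {U : Set M} {e : Fin 4 → ∀ x : M, Tan 4 x}
  [IsContMDiffRiemannianBundle (𝓡 4) ∞ (EuclideanSpace ℝ (Fin 4))
      (fun x : M => TangentSpace (𝓡 4) x)]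

open smoothAlg

namespace IsOrthoFrame

lemma smoothOn_structFun (hF : IsOrthoFrame U e) (i j k : Fin 4) :
    SmoothOn 4 (structFun e i j k) U :=
  ContMDiffOn.sub (hF.smoothOn_christoffel i j k) (hF.smoothOn_christoffel j i k)

/-- The algebraic data of an orthonormal frame. -/
def frameAlg (hF : IsOrthoFrame U e) : FrameAlg (smoothAlg U) where
  E i := derivation hF.isOpen (e i) (hF.smooth i)
  Γ i j k := restrict _ (hF.smoothOn_christoffel i j k)
  anti i j k := ext_eval fun x => by
    rw [map_neg]
    exact hF.christoffel_antisymm x.2 i j k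
  comm i j φ := ext_eval fun x => by
    rw [← restrict_extZero φ]
    simp only [derivation_restrict, map_sub, map_sum, map_mul, eval_restrict]
    exact hF.dirDeriv_comm (smoothOn_extZero φ) x.2 i j
  jacobi i j k l := ext_eval fun x => by
    have hr : ∀ i j k, restrict _ (hF.smoothOn_christoffel i j k)
        - restrict _ (hF.smoothOn_christoffel j i k) = restrict (structFun e i j k)
          (hF.smoothOn_structFun i j k) :=
      fun i j k => rfl
    simp only [hr, derivation_restrict, map_add, map_sum, map_mul, map_zero, eval_restrict]
    exact hF.structFun_jacobi x.2 i j k l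

lemma eval_rm (hF : IsOrthoFrame U e) (x : U) (i j k l : Fin 4) :
    eval x (hF.frameAlg.rm i j k l) = frameRiem e i j k l x := by
  simp only [FrameAlg.rm, frameAlg, derivation_restrict, map_add, map_sub, map_sum, map_mul,
    eval_restrict]
  rfl

lemma eval_ric (hF : IsOrthoFrame U e) (x : U) (j k : Fin 4) :
    eval x (hF.frameAlg.ric j k) = frameRic e j k x := by
  simp only [FrameAlg.ric, map_sum, hF.eval_rm]
  rfl

lemma eval_sc (hF : IsOrthoFrame U e) (x : U) : eval x hF.frameAlg.sc = frameScal e x := by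
  simp only [FrameAlg.sc, map_sum, hF.eval_ric]
  rfl

lemma eval_δ (x : U) (i j : Fin 4) : eval x (FrameAlg.δ (smoothAlg U) i j) = kron i j := by
  unfold FrameAlg.δ kron
  split_ifs <;> simp

lemma weyl6_eq (hF : IsOrthoFrame U e) (i j k l : Fin 4) :
    hF.frameAlg.weyl6 i j k l = algebraMap ℝ _ 6 * restrict _ (hF.smoothOn_frameWeyl i j k l) :=
  ext_eval fun x => by
    simp only [FrameAlg.weyl6, map_add, map_sub, map_mul, map_ofNat, hF.eval_rm, hF.eval_ric,
      hF.eval_sc, eval_δ, eval_restrict, frameWeyl]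
    ring

lemma sum_cov4_weyl6 (hF : IsOrthoFrame U e) (hW : HarmonicWeyl 4 M) (j k l : Fin 4) :
    ∑ i, hF.frameAlg.cov4 hF.frameAlg.weyl6 i i j k l = 0 :=
  ext_eval fun x => by
    have hc : ∀ i, eval x (hF.frameAlg.cov4 hF.frameAlg.weyl6 i i j k l)
        = 6 * frameCov e (frameWeyl e) i i j k l x := by
      intro i
      simp only [FrameAlg.cov4, hF.weyl6_eq]
      simp only [frameAlg, derivation_restrict, Derivation.leibniz, Derivation.map_algebraMap,
        smul_eq_mul, map_sub, map_mul, mul_zero, add_zero, map_sum, map_add, AlgHom.commutes,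
        eval_restrict, frameCov, Algebra.algebraMap_self, RingHom.id_apply, mul_sub,
        Finset.mul_sum]
      congr 1
      exact Finset.sum_congr rfl fun p _ => by ring
    simp only [map_sum, hc, map_zero]
    rw [← Finset.mul_sum, hF.sum_frameCov_frameWeyl hW x.2, mul_zero]

end IsOrthoFrame

lemma metric_grad (f : M → ℝ) (x : M) (v : Tan 4 x) : metric x (grad f x) v = dirDeriv f x v :=
  metric_extend_sum (dirDeriv_add_right f x) (dirDeriv_smul_right f x) v

namespace IsAdaptedFrame

variable {f : M → ℝ} {ev : Fin 4 → M → ℝ}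

lemma isOrthoFrame (h : IsAdaptedFrame f U e ev) : IsOrthoFrame U e :=
  ⟨h.isOpen, h.smooth, h.orthonormal⟩

lemma frameRic_eq (h : IsAdaptedFrame f U e ev) {x : M} (hx : x ∈ U) (i j : Fin 4) :
    frameRic e i j x = ev i x * kron i j := by
  rw [← h.isOrthoFrame.ricci_frame hx, h.eigen x hx, h.orthonormal x hx]
  rfl

/-- Smoothness of the eigenfunctions is not part of the frame data; it holds because they are the
diagonal Ricci coefficients of a smooth frame. -/
lemma smoothOn_ev (h : IsAdaptedFrame f U e ev) (i : Fin 4) : SmoothOn 4 (ev i) U :=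
  (h.isOrthoFrame.smoothOn_frameRic i i).congr fun x hx => by
    rw [h.frameRic_eq hx, kron, if_pos rfl, mul_one]

/-- The remaining frame fields annihilate `f`, so otherwise the gradient would vanish. -/
lemma dirDeriv_first_ne_zero (h : IsAdaptedFrame f U e ev) {x : M} (hx : x ∈ U) :
    dirDeriv f x (e 0 x) ≠ 0 := by
  intro h0
  refine (h.subset hx).2 (h.isOrthoFrame.eq_of_metric_eq hx fun i => ?_)
  rw [metric_grad, ← zero_smul ℝ (e 0 x), metric_smul_left, zero_mul]
  by_cases hi : i = 0
  · rw [hi, h0]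
  · exact h.tangent x hx i hi

lemma dirDeriv_eq (h : IsAdaptedFrame f U e ev) {x : M} (hx : x ∈ U) (i : Fin 4) :
    dirDeriv f x (e i x) = dirDeriv f x (e 0 x) * kron i 0 := by
  unfold kron
  split_ifs with hi
  · rw [hi, mul_one]
  · rw [mul_zero, h.tangent x hx i hi]

/-- The algebraic data of an adapted frame whose last three Ricci eigenvalues are distinct. -/
def solitonAlg (h : IsAdaptedFrame f U e ev) {lam : ℝ} (hsol : IsGradientSoliton 4 f lam)
    (hW : HarmonicWeyl 4 M)
    (hne : ∀ x ∈ U, ∀ i j : Fin 4, i ≠ 0 → j ≠ 0 → i ≠ j → ev i x ≠ ev j x) :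
    SolitonAlg (smoothAlg U) U where
  toFrameAlg := h.isOrthoFrame.frameAlg
  ε := eval
  sep _ _ := ext_eval
  ev i := restrict _ (h.smoothOn_ev i)
  p := restrict _ (smoothOn_dirDeriv h.isOpen hsol.smooth.contMDiffOn (h.smooth 0))
  lam := lam
  ric_eq i j := ext_eval fun x => by
    rw [h.isOrthoFrame.eval_ric, h.frameRic_eq x.2, map_mul, IsOrthoFrame.eval_δ, eval_restrict]
  hess_eq i j := ext_eval fun x => by
    have hF := h.isOrthoFrame
    -- Here `p * δ j 0` is just the derivative of `f` along `e j`, which identifies the algebraic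
    -- equation with the Hessian formula.
    have hj : restrict _ (smoothOn_dirDeriv h.isOpen hsol.smooth.contMDiffOn (h.smooth 0))
        * FrameAlg.δ (smoothAlg U) j 0
        = restrict _ (smoothOn_dirDeriv h.isOpen hsol.smooth.contMDiffOn (h.smooth j)) :=
      ext_eval fun y => by
        rw [map_mul, IsOrthoFrame.eval_δ, eval_restrict, eval_restrict, ← h.dirDeriv_eq y.2]
    have hh := hF.hess_frame hsol.smooth.contMDiffOn x.2 i j
    rw [hsol.equation, hF.ricci_frame x.2, h.frameRic_eq x.2, h.orthonormal x x.2,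
      Finset.sum_eq_single 0 (fun k _ hk => by rw [h.tangent x x.2 k hk, zero_mul]) (by simp)] at hh
    rw [hj]
    simp only [IsOrthoFrame.frameAlg, derivation_restrict, map_add, map_sub, map_mul,
      AlgHom.commutes, eval_restrict, IsOrthoFrame.eval_δ]
    rw [← hh]
    simp only [kron, Algebra.algebraMap_self, RingHom.id_apply]
    ring
  div_weyl := h.isOrthoFrame.sum_cov4_weyl6 hW
  p_ne x := h.dirDeriv_first_ne_zero x.2
  ev_ne x := hne x x.2

end IsAdaptedFrame

end FrameData

end Soliton

end

/-! ### Conclusion for the adapted frame. -/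

theorem mainTheorem6 {M : Type*} [TopologicalSpace M] [T2Space M] [SecondCountableTopology M]
    [ChartedSpace (EuclideanSpace ℝ (Fin 4)) M] [IsManifold (𝓡 4) ∞ M]
    [RiemannianBundle (fun x : M => TangentSpace (𝓡 4) x)]
    [IsContMDiffRiemannianBundle (𝓡 4) ∞ (EuclideanSpace ℝ (Fin 4))
      (fun x : M => TangentSpace (𝓡 4) x)]
    (f : M → ℝ) (lam : ℝ)
    (hsol : Soliton.IsGradientSoliton 4 f lam)
    (hW : Soliton.HarmonicWeyl 4 M)
    (hf : ¬ ∃ c : ℝ, ∀ x, f x = c)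
    (U : Set M) (e : Fin 4 → ∀ x : M, Soliton.Tan 4 x) (ev : Fin 4 → M → ℝ)
    (hframe : Soliton.IsAdaptedFrame f U e ev) :
    (∀ x ∈ U, ev 1 x = ev 2 x) ∨ (∀ x ∈ U, ev 1 x = ev 3 x) ∨ (∀ x ∈ U, ev 2 x = ev 3 x) := by
  obtain ⟨k, d, -, -, hd⟩ := hframe.blocks
  by_contra hcon
  push Not at hcon
  obtain ⟨⟨x₀, hx₀, h12⟩, ⟨x₁, hx₁, h13⟩, ⟨x₂, hx₂, h23⟩⟩ := hcon
  -- The three inequalities may occur at different points, but the block index `d` does not depend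
  -- on the point, so each of them spreads to all of `U`.
  rw [Ne, hd x₀ hx₀] at h12
  rw [Ne, hd x₁ hx₁] at h13
  rw [Ne, hd x₂ hx₂] at h23
  have hne : ∀ x ∈ U, ∀ i j : Fin 4, i ≠ 0 → j ≠ 0 → i ≠ j → ev i x ≠ ev j x := by
    intro x hx i j hi hj hij
    rw [Ne, hd x hx]
    fin_cases i <;> fin_cases j <;> first
      | exact absurd rfl hi
      | exact absurd rfl hj
      | exact absurd rfl hij
      | assumption
      | exact fun h => h12 h.symm
      | exact fun h => h13 h.symm
      | exact fun h => h23 h.symm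
  exact (hframe.solitonAlg hsol hW hne).elim ⟨x₀, hx₀⟩
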